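/- **Theorem 4.** *Setting.* For $l=1,2$ let $X_l\subset\mathbb R^{m_l}$ be nonempty, compact and convex, let $\|\cdot\|$ be a norm on $\mathbb R^{m_l}$ with dual norm $\|\cdot\|_*$, and let network $\Sigma_l$ have $n_l$ agents, $\mathcal V_l=\{1,\dots,n_l\}$. Agent $i$ of $\Sigma_l$ has the cost $f_{l,i}(x_1,x_2)=\mathbb E[F_{l,i}(x_1,x_2;\xi)]$ on $X_1\times X_2$, where $\xi$ is an $\mathbb R^d$-valued random vector, and $$U(x_1,x_2)=\frac1{n_1}\sum_{i=1}^{n_1}f_{1,i}(x_1,x_2)=-\frac1{n_2}\sum_{j=1}^{n_2}f_{2,j}(x_1,x_2).$$ *Networks.* Fix $0<\eta<1$. At time $t\ge0$ the agents of $\Sigma_l$ communicate along a digraph $(\mathcal V_l,\mathcal E_l(t))$ that contains all self-loops $(i,i)$, with a doubly stochastic matrix $W_l(t)=[w_{l,ij}(t)]$ such that $w_{l,ij}(t)\ge\eta$ if $(j,i)\in\mathcal E_l(t)$ and $w_{l,ij}(t)=0$ otherwise; there is an integer $B_l\ge1$ such that the union of the graphs of any $B_l$ consecutive times is strongly connected.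 Between the networks, agent $i\in\mathcal V_l$ uses nonnegative weights $w_{12,ij}(t)$, $j\in\mathcal V_{3-l}$, with $\sum_j w_{12,ij}(t)=1$, which are positive only along the edges of a bipartite digraph. Put $\Gamma_l=(1-\eta/4n_l^2)^{-2}$ and $\theta_l=(1-\eta/4n_l^2)^{1/B_l}$. *Algorithm (D-SMD).* Let $\psi_l$ be a differentiable function on $X_l$, $1$-strongly convex with respect to $\|\cdot\|$, with Bregman divergence $D_{\psi_l}(x,p)=\psi_l(x)-\psi_l(p)-\langle\nabla\psi_l(p),x-p\rangle$ bounded on $X_l\times X_l$, put $R_l^2=\sup\{D_{\psi_l}(x,x'):x,x'\in X_l\}$, and let $P^l_p(y)=\arg\min_{x'\in X_l}\{\langle y,p-x'\rangle+D_{\psi_l}(x',p)\}$. Let $\alpha(0)\ge\alpha(1)\ge\dots\ge0$ with $\alpha(0)>0$, and let $x_{l,i}(0)\in X_l$ be (possibly random) initial states. For $t\ge0$ put $v_{l,i}(t)=\sum_{j}w_{l,ij}(t)x_{l,j}(t)$ and $u_{3-l,i}(t)=\sum_{j}w_{12,ij}(t)x_{3-l,j}(t)$ for $i\in\mathcal V_l$;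 agent $i\in\mathcal V_l$ receives a sampled subgradient $\hat g_{l,i}(t)$, that is, a subgradient with respect to $x_l\in X_l$ of $F_{l,i}(\cdot\,;\xi_{l,i}(t))$ at $x_l=v_{l,i}(t)$, with $x_{3-l}=u_{3-l,i}(t)$ fixed, and sets $x_{l,i}(t+1)=P^l_{v_{l,i}(t)}(-\alpha(t)\hat g_{l,i}(t))$. The samples $\xi_{l,i}(t)$ are independent copies of $\xi$. Let $\mathcal F_t$ be the $\sigma$-algebra generated by all $x_{l,i}(0)$ and all $\xi_{l,i}(s)$, $s<t$; $\hat g_{l,i}(t)$ is $\mathcal F_{t+1}$-measurable. Let $\Lambda_l=\mathbb E\left[\max_{i\in\mathcal V_l}\|x_{l,i}(0)\|\right]$ (so $\Lambda_l=\max_i\|x_{l,i}(0)\|$ for deterministic initial states). *Assumptions.* Every $f_{1,i}$ is convex in $x_1$ and concave in $x_2$, every $f_{2,j}$ is concave in $x_1$ and convex in $x_2$, and: (A1) there is $L>0$ with $|f_{l,i}(x_1,x_2)-f_{l,i}(x_1',x_2')|\le L(\|x_1-x_1'\|+\|x_2-x_2'\|)$ on $X_1\times X_2$, for all $l,i$;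 (A2) there are $\nu_1,\nu_2>0$ such that, for all $l,i,t$, $\hat g_{l,i}(t)$ is integrable, $\mathbb E[\hat g_{l,i}(t)\mid\mathcal F_t]=g_{l,i}(t)$ and $\mathbb E[\|g_{l,i}(t)-\hat g_{l,i}(t)\|_*^2\mid\mathcal F_t]\le\nu_l^2$, where $g_{l,i}(t)$ is a subgradient with respect to $x_l\in X_l$ of $f_{l,i}$ at $x_l=v_{l,i}(t)$, with $x_{3-l}=u_{3-l,i}(t)$ fixed, and $\|g_{l,i}(t)\|_*\le L$; (A3) for $l=1,2$, $D_{\psi_l}(x,y)$ is convex in $y$, and $x_k\to x$ implies $D_{\psi_l}(x_k,x)\to0$. *Conclusion.* For all $i\in\mathcal V_1$, $j\in\mathcal V_2$ and $t\ge1$, with $\hat x_{l,i}(t)=\sum_{s=0}^{t-1}\alpha(s)x_{l,i}(s)\big/\sum_{s=0}^{t-1}\alpha(s)$, the gap $$\delta(\hat x_{1,i}(t),\hat x_{2,j}(t))=\max_{x_2\in X_2}U(\hat x_{1,i}(t),x_2)-\min_{x_1\in X_1}U(x_1,\hat x_{2,j}(t))$$ is integrable and $$\mathbb E\left[\delta(\hat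 x_{1,i}(t),\hat x_{2,j}(t))\right]\le\frac{M_1+M_2\sum_{s=0}^{t-1}\alpha^2(s)}{\sum_{s=0}^{t-1}\alpha(s)},$$ where $$M_1=\sum_{l=1}^2\left(\frac{4Ln_l\Gamma_l\Lambda_l\alpha(0)}{1-\theta_l}+2R_l^2\right),\qquad M_2=\sum_{l=1}^2\left(4L(L+\nu_l)\left(\frac{n_l\Gamma_l}{1-\theta_l}+2\right)+(L+\nu_l)^2+\frac{\nu_l^2}2\right).$$ -/

import Mathlib

open MeasureTheory ProbabilityTheory Set Filter Topology

noncomputable section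

namespace DSMD

section OneSpace

variable {E : Type*} [NormedAddCommGroup E] [NormedSpace ℝ E]

/-- `g` is a subgradient at `v` of the function `h`, regarded as a function on `X`. -/
def IsSubgradientOn (X : Set E) (h : E → ℝ) (v : E) (g : StrongDual ℝ E) : Prop :=
  ∀ y ∈ X, h v + g (y - v) ≤ h y

/-- The Bregman divergence `D_ψ(x, p) = ψ(x) - ψ(p) - ⟨∇ψ(p), x - p⟩` of a regularizer `ψ` on `X`.
For `x, p` in a convex set `X` the last term is the derivative of `ψ` at `p` in the feasible
direction `x - p`, so it does not depend on the choice of the derivative within `X`. -/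
def bregman (X : Set E) (ψ : E → ℝ) (x p : E) : ℝ :=
  ψ x - ψ p - fderivWithin ℝ ψ X p (x - p)

/-- The values of the Bregman divergence on `X × X`. -/
def bregmanValues (X : Set E) (ψ : E → ℝ) : Set ℝ :=
  {r | ∃ x ∈ X, ∃ x' ∈ X, r = bregman X ψ x x'}

/-- The squared Bregman diameter `R² = max {D_ψ(x, x') : x, x' ∈ X}`. -/
def bregmanDiamSq (X : Set E) (ψ : E → ℝ) : ℝ := sSup (bregmanValues X ψ)

/-- `ψ` is a differentiable regularizer on `X`, `1`-strongly convex for the norm of `E`, whose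
Bregman divergence is bounded on `X × X` (this is automatic when `ψ` is continuously
differentiable on a neighbourhood of the compact set `X`). -/
structure IsRegularizer (X : Set E) (ψ : E → ℝ) : Prop where
  strongConvexOn : StrongConvexOn X 1 ψ
  differentiableOn : DifferentiableOn ℝ ψ X
  bddAbove : BddAbove (bregmanValues X ψ)

/-- The Bregman divergence is convex in its second argument, and `x_k → x` implies
`D_ψ(x_k, x) → 0`. -/
structure BregmanAssumption (X : Set E) (ψ : E → ℝ) : Prop where
  convexOn_right : ∀ x ∈ X, ConvexOn ℝ X (fun y => bregman X ψ x y)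
  reciprocity : ∀ (z : ℕ → E) (x : E), (∀ k, z k ∈ X) → x ∈ X → Tendsto z atTop (𝓝 x) →
    Tendsto (fun k => bregman X ψ (z k) x) atTop (𝓝 0)

/-- `q` is the value of the prox-mapping
`P_p(y) = argmin_{x' ∈ X} {⟨y, p - x'⟩ + D_ψ(x', p)}`. -/
def IsProx (X : Set E) (ψ : E → ℝ) (p : E) (y : StrongDual ℝ E) (q : E) : Prop :=
  q ∈ X ∧ ∀ x' ∈ X, y (p - q) + bregman X ψ q p ≤ y (p - x') + bregman X ψ x' p

/-- The weighted average `∑_j w_{ij} x_j` computed by agent `i`. -/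
def mix {m n : ℕ} (w : Matrix (Fin m) (Fin n) ℝ) (x : Fin n → E) (i : Fin m) : E :=
  ∑ j, w i j • x j

/-- The step-size weighted time average of `x(0), …, x(t-1)`. -/
def timeAvg (α : ℕ → ℝ) (x : ℕ → E) (t : ℕ) : E :=
  (∑ s ∈ Finset.range t, α s)⁻¹ • ∑ s ∈ Finset.range t, α s • x s

end OneSpace

section TwoSpaces

variable {E F : Type*} [NormedAddCommGroup E] [NormedSpace ℝ E]
  [NormedAddCommGroup F] [NormedSpace ℝ F]

/-- `h` is convex in its first argument and concave in its second one. -/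
def ConvexConcaveOn (X : Set E) (Y : Set F) (h : E → F → ℝ) : Prop :=
  (∀ y ∈ Y, ConvexOn ℝ X (fun x => h x y)) ∧ (∀ x ∈ X, ConcaveOn ℝ Y (fun y => h x y))

/-- `|h(x, y) - h(x', y')| ≤ L (‖x - x'‖ + ‖y - y'‖)` on `X × Y`. -/
def LipOn (X : Set E) (Y : Set F) (L : ℝ) (h : E → F → ℝ) : Prop :=
  ∀ x ∈ X, ∀ x' ∈ X, ∀ y ∈ Y, ∀ y' ∈ Y, |h x y - h x' y'| ≤ L * (‖x - x'‖ + ‖y - y'‖)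

end TwoSpaces

/-- One network of `n` agents: a sequence of digraphs (`(G t).Adj j i` means that `i` receives
from `j` at time `t`) and of mixing matrices. Every agent uses its own state, the weights are at
least `η` on the edges and vanish elsewhere, the matrices are doubly stochastic, and the union of
any `B` consecutive graphs is strongly connected. -/
structure IsMixing {n : ℕ} (η : ℝ) (B : ℕ) (G : ℕ → Digraph (Fin n))
    (W : ℕ → Matrix (Fin n) (Fin n) ℝ) : Prop where
  self_loop : ∀ t i, (G t).Adj i i
  le_weight : ∀ t i j, (G t).Adj j i → η ≤ W t i j
  weight_eq_zero : ∀ t i j, ¬ (G t).Adj j i → W t i j = 0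
  row_sum : ∀ t i, ∑ j, W t i j = 1
  col_sum : ∀ t j, ∑ i, W t i j = 1
  one_le : 1 ≤ B
  connected : ∀ k i j,
    Relation.ReflTransGen (fun a b => ∃ t, k ≤ t ∧ t < k + B ∧ (G t).Adj a b) i j

/-- The communication structure of the two networks and of the bipartite network between them.
`W₁₂ t i j` is the weight that agent `i` of the first network gives to agent `j` of the second
one, and `W₂₁ t j i` the weight that agent `j` of the second network gives to agent `i` of the
first one. -/
structure Network (n₁ n₂ : ℕ) (η : ℝ) (B₁ B₂ : ℕ) where
  G₁ : ℕ → Digraph (Fin n₁)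
  G₂ : ℕ → Digraph (Fin n₂)
  G₁₂ : ℕ → Digraph (Fin n₁ ⊕ Fin n₂)
  W₁ : ℕ → Matrix (Fin n₁) (Fin n₁) ℝ
  W₂ : ℕ → Matrix (Fin n₂) (Fin n₂) ℝ
  W₁₂ : ℕ → Matrix (Fin n₁) (Fin n₂) ℝ
  W₂₁ : ℕ → Matrix (Fin n₂) (Fin n₁) ℝ
  η_pos : 0 < η
  η_lt_one : η < 1
  mixing₁ : IsMixing η B₁ G₁ W₁
  mixing₂ : IsMixing η B₂ G₂ W₂
  bipartite : ∀ t a b, (G₁₂ t).Adj a b → a.isLeft ≠ b.isLeft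
  nonneg₁₂ : ∀ t i j, 0 ≤ W₁₂ t i j
  nonneg₂₁ : ∀ t j i, 0 ≤ W₂₁ t j i
  edge₁₂ : ∀ t i j, 0 < W₁₂ t i j → (G₁₂ t).Adj (Sum.inr j) (Sum.inl i)
  edge₂₁ : ∀ t j i, 0 < W₂₁ t j i → (G₁₂ t).Adj (Sum.inl i) (Sum.inr j)
  row_sum₁₂ : ∀ t i, ∑ j, W₁₂ t i j = 1
  row_sum₂₁ : ∀ t j, ∑ i, W₂₁ t j i = 1

/-- `Γ = (1 - η / (4 n²))⁻²`. -/
def Gam (η : ℝ) (n : ℕ) : ℝ := ((1 - η / (4 * (n : ℝ) ^ 2)) ^ 2)⁻¹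

/-- `θ = (1 - η / (4 n²))^{1/B}`. -/
def theta (η : ℝ) (n B : ℕ) : ℝ := (1 - η / (4 * (n : ℝ) ^ 2)) ^ (1 / (B : ℝ))

section Game

variable {Ω E₁ E₂ : Type*} [MeasurableSpace Ω]
  [NormedAddCommGroup E₁] [NormedSpace ℝ E₁] [NormedAddCommGroup E₂] [NormedSpace ℝ E₂]

/-- The average `(1/n) ∑_i f_i` of cost functions. -/
def avgCost {n : ℕ} (f : Fin n → E₁ → E₂ → ℝ) (x₁ : E₁) (x₂ : E₂) : ℝ :=
  (1 / (n : ℝ)) * ∑ i, f i x₁ x₂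

/-- The expected cost `f(x₁, x₂) = 𝔼[F(x₁, x₂; ξ)]`. -/
def expCost {d n : ℕ} (P : Measure Ω) (F : Fin n → E₁ → E₂ → (Fin d → ℝ) → ℝ)
    (ξ : Ω → Fin d → ℝ) (i : Fin n) (x₁ : E₁) (x₂ : E₂) : ℝ :=
  ∫ ω, F i x₁ x₂ (ξ ω) ∂P

/-- A two-network stochastic zero-sum game: compact convex strategy sets, sampled costs of the
agents of both networks (only their values on `X₁ × X₂` matter), and the random vector that
they depend on. -/
structure Game (P : Measure Ω) (E₁ E₂ : Type*) [NormedAddCommGroup E₁] [NormedSpace ℝ E₁]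
    [NormedAddCommGroup E₂] [NormedSpace ℝ E₂] (n₁ n₂ d : ℕ) where
  X₁ : Set E₁
  X₂ : Set E₂
  F₁ : Fin n₁ → E₁ → E₂ → (Fin d → ℝ) → ℝ
  F₂ : Fin n₂ → E₁ → E₂ → (Fin d → ℝ) → ℝ
  ξ : Ω → Fin d → ℝ
  nonempty₁ : X₁.Nonempty
  nonempty₂ : X₂.Nonempty
  compact₁ : IsCompact X₁
  compact₂ : IsCompact X₂
  convex₁ : Convex ℝ X₁
  convex₂ : Convex ℝ X₂
  measurable_ξ : Measurable ξ
  integrable₁ : ∀ i, ∀ x₁ ∈ X₁, ∀ x₂ ∈ X₂, Integrable (fun ω => F₁ i x₁ x₂ (ξ ω)) P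
  integrable₂ : ∀ j, ∀ x₁ ∈ X₁, ∀ x₂ ∈ X₂, Integrable (fun ω => F₂ j x₁ x₂ (ξ ω)) P
  zero_sum : ∀ x₁ ∈ X₁, ∀ x₂ ∈ X₂,
    avgCost (expCost P F₁ ξ) x₁ x₂ = -avgCost (expCost P F₂ ξ) x₁ x₂

namespace Game

variable {P : Measure Ω} {n₁ n₂ d : ℕ} (Γ : Game P E₁ E₂ n₁ n₂ d)

/-- The expected cost of agent `i` of the first network. -/
def f₁ (i : Fin n₁) (x₁ : E₁) (x₂ : E₂) : ℝ := expCost P Γ.F₁ Γ.ξ i x₁ x₂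

/-- The expected cost of agent `j` of the second network. -/
def f₂ (j : Fin n₂) (x₁ : E₁) (x₂ : E₂) : ℝ := expCost P Γ.F₂ Γ.ξ j x₁ x₂

/-- The cost function `U = (1/n₁) ∑ f_{1,i} = -(1/n₂) ∑ f_{2,j}` of the game. -/
def U (x₁ : E₁) (x₂ : E₂) : ℝ := avgCost Γ.f₁ x₁ x₂

/-- The gap `max_{x₂ ∈ X₂} U(y₁, x₂) - min_{x₁ ∈ X₁} U(x₁, y₂)`. -/
def gap (y₁ : E₁) (y₂ : E₂) : ℝ :=
  sSup ((fun x₂ => Γ.U y₁ x₂) '' Γ.X₂) - sInf ((fun x₁ => Γ.U x₁ y₂) '' Γ.X₁)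

/-- Every `f_{1,i}` is convex-concave and every `f_{2,j}` is concave-convex. -/
def CostsConvexConcave : Prop :=
  (∀ i, ConvexConcaveOn Γ.X₁ Γ.X₂ (Γ.f₁ i)) ∧
    (∀ j, ConvexConcaveOn Γ.X₂ Γ.X₁ (fun x₂ x₁ => Γ.f₂ j x₁ x₂))

/-- All the costs are Lipschitz continuous on `X₁ × X₂` with constant `L > 0`. -/
def LipschitzAssumption (L : ℝ) : Prop :=
  0 < L ∧ (∀ i, LipOn Γ.X₁ Γ.X₂ L (Γ.f₁ i)) ∧ (∀ j, LipOn Γ.X₁ Γ.X₂ L (Γ.f₂ j))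

end Game

/-- `ℱ_t`, the `σ`-algebra generated by the initial states and by the samples drawn before
time `t`. -/
@[reducible] def history [MeasurableSpace E₁] [MeasurableSpace E₂] {n₁ n₂ d : ℕ} (x₁ : Fin n₁ → Ω → E₁)
    (x₂ : Fin n₂ → Ω → E₂) (ξ : ℕ → Fin n₁ ⊕ Fin n₂ → Ω → Fin d → ℝ) (t : ℕ) :
    MeasurableSpace Ω :=
  (⨆ i, MeasurableSpace.comap (x₁ i) inferInstance) ⊔
    (⨆ j, MeasurableSpace.comap (x₂ j) inferInstance) ⊔
    (⨆ (s : ℕ) (_ : s < t) (k : Fin n₁ ⊕ Fin n₂), MeasurableSpace.comap (ξ s k) inferInstance)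

/-- A run of distributed stochastic mirror descent with step sizes `α` and regularizers
`ψ₁, ψ₂`: states `x`, independent samples `ξ` distributed as the random vector of the game, and
sampled subgradients `g`, chosen as functions of the information available at the time. -/
structure Run {P : Measure Ω} {n₁ n₂ d : ℕ} [MeasurableSpace E₁] [MeasurableSpace E₂]
    (Γ : Game P E₁ E₂ n₁ n₂ d) {η : ℝ} {B₁ B₂ : ℕ} (N : Network n₁ n₂ η B₁ B₂)
    (ψ₁ : E₁ → ℝ) (ψ₂ : E₂ → ℝ) (α : ℕ → ℝ) where
  x₁ : ℕ → Fin n₁ → Ω → E₁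
  x₂ : ℕ → Fin n₂ → Ω → E₂
  ξ : ℕ → Fin n₁ ⊕ Fin n₂ → Ω → Fin d → ℝ
  g₁ : ℕ → Fin n₁ → Ω → StrongDual ℝ E₁
  g₂ : ℕ → Fin n₂ → Ω → StrongDual ℝ E₂
  measurable_init₁ : ∀ i, Measurable (x₁ 0 i)
  measurable_init₂ : ∀ j, Measurable (x₂ 0 j)
  init_mem₁ : ∀ i ω, x₁ 0 i ω ∈ Γ.X₁
  init_mem₂ : ∀ j ω, x₂ 0 j ω ∈ Γ.X₂
  measurable_ξ : ∀ t k, Measurable (ξ t k)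
  indep : iIndepFun (fun p : ℕ × (Fin n₁ ⊕ Fin n₂) => ξ p.1 p.2) P
  identDistrib : ∀ t k, IdentDistrib (ξ t k) Γ.ξ P P
  subgradient₁ : ∀ t i ω, IsSubgradientOn Γ.X₁
    (fun y => Γ.F₁ i y (mix (N.W₁₂ t) (fun j => x₂ t j ω) i) (ξ t (Sum.inl i) ω))
    (mix (N.W₁ t) (fun k => x₁ t k ω) i) (g₁ t i ω)
  subgradient₂ : ∀ t j ω, IsSubgradientOn Γ.X₂
    (fun y => Γ.F₂ j (mix (N.W₂₁ t) (fun i => x₁ t i ω) j) y (ξ t (Sum.inr j) ω))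
    (mix (N.W₂ t) (fun k => x₂ t k ω) j) (g₂ t j ω)
  measurable_g₁ : ∀ t i, StronglyMeasurable[history (x₁ 0) (x₂ 0) ξ (t + 1)] (g₁ t i)
  measurable_g₂ : ∀ t j, StronglyMeasurable[history (x₁ 0) (x₂ 0) ξ (t + 1)] (g₂ t j)
  step₁ : ∀ t i ω, IsProx Γ.X₁ ψ₁ (mix (N.W₁ t) (fun k => x₁ t k ω) i) (-(α t • g₁ t i ω))
    (x₁ (t + 1) i ω)
  step₂ : ∀ t j ω, IsProx Γ.X₂ ψ₂ (mix (N.W₂ t) (fun k => x₂ t k ω) j) (-(α t • g₂ t j ω))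
    (x₂ (t + 1) j ω)

/-- Given the past `ℱ`, the sampled subgradient `ghat` is an unbiased estimate, with conditional
variance at most `ν²`, of a subgradient of `h ω` on `X` at `v ω`. The subgradient is one of those
that an `L`-Lipschitz function has on the whole space, that is, of dual norm at most `L`; for
`v ω` in the interior of `X` this is automatic if `h ω` is `L`-Lipschitz on `X`. -/
def UnbiasedBounded {E : Type*} [NormedAddCommGroup E] [NormedSpace ℝ E] (P : Measure Ω)
    (ℱ : MeasurableSpace Ω) (X : Set E) (h : Ω → E → ℝ) (v : Ω → E)
    (ghat : Ω → StrongDual ℝ E) (L ν : ℝ) : Prop :=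
  ∃ g : Ω → StrongDual ℝ E,
    (∀ᵐ ω ∂P, IsSubgradientOn X (h ω) (v ω) (g ω) ∧ ‖g ω‖ ≤ L) ∧
    Integrable ghat P ∧ P[ghat | ℱ] =ᵐ[P] g ∧
    Integrable (fun ω => ‖g ω - ghat ω‖ ^ 2) P ∧
    P[fun ω => ‖g ω - ghat ω‖ ^ 2 | ℱ] ≤ᵐ[P] fun _ => ν ^ 2

namespace Run

variable {P : Measure Ω} {n₁ n₂ d : ℕ} [MeasurableSpace E₁] [MeasurableSpace E₂]
  {Γ : Game P E₁ E₂ n₁ n₂ d} {η : ℝ} {B₁ B₂ : ℕ} {N : Network n₁ n₂ η B₁ B₂}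
  {ψ₁ : E₁ → ℝ} {ψ₂ : E₂ → ℝ} {α : ℕ → ℝ} (R : Run Γ N ψ₁ ψ₂ α)

/-- The sampled subgradients of all the agents are conditionally unbiased, with conditional
variances at most `ν₁²` and `ν₂²`. -/
def SamplingAssumption (L ν₁ ν₂ : ℝ) : Prop :=
  0 < ν₁ ∧ 0 < ν₂ ∧
  (∀ t i, UnbiasedBounded P (history (R.x₁ 0) (R.x₂ 0) R.ξ t) Γ.X₁
    (fun ω y => Γ.f₁ i y (mix (N.W₁₂ t) (fun j => R.x₂ t j ω) i))
    (fun ω => mix (N.W₁ t) (fun k => R.x₁ t k ω) i) (R.g₁ t i) L ν₁) ∧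
  (∀ t j, UnbiasedBounded P (history (R.x₁ 0) (R.x₂ 0) R.ξ t) Γ.X₂
    (fun ω y => Γ.f₂ j (mix (N.W₂₁ t) (fun i => R.x₁ t i ω) j) y)
    (fun ω => mix (N.W₂ t) (fun k => R.x₂ t k ω) j) (R.g₂ t j) L ν₂)

/-- `Λ₁ = max_i ‖x_{1,i}(0)‖`, in expectation if the initial states are random. -/
def Lam₁ : ℝ := ∫ ω, (⨆ i, ‖R.x₁ 0 i ω‖) ∂P

/-- `Λ₂ = max_j ‖x_{2,j}(0)‖`, in expectation if the initial states are random. -/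
def Lam₂ : ℝ := ∫ ω, (⨆ j, ‖R.x₂ 0 j ω‖) ∂P

end Run

end Game

/-- The contribution `4 L n Γ Λ α(0) / (1 - θ) + 2 R²` of one network to the constant `M₁`. -/
def constM₁ (L η : ℝ) (n B : ℕ) (Λ α₀ Rsq : ℝ) : ℝ :=
  4 * L * n * Gam η n * Λ * α₀ / (1 - theta η n B) + 2 * Rsq

/-- The contribution `4 L (L + ν) (n Γ / (1 - θ) + 2) + (L + ν)² + ν² / 2` of one network to the
constant `M₂`. -/
def constM₂ (L ν η : ℝ) (n B : ℕ) : ℝ :=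
  4 * L * (L + ν) * (n * Gam η n / (1 - theta η n B) + 2) + (L + ν) ^ 2 + ν ^ 2 / 2

end DSMD

end

noncomputable section

namespace DSMD

section Mixing

open Matrix

variable {n : ℕ}

/-- The sum of the squared deviations of `z` from its mean. -/
def spread (z : Fin n → ℝ) : ℝ := ∑ i, (z i - (∑ j, z j) / n) ^ 2

/-- The loss of energy `∑ z_i²` under `W`, up to a factor of two. -/
def dissipation (W : Matrix (Fin n) (Fin n) ℝ) (z : Fin n → ℝ) : ℝ :=
  ∑ i, ∑ j, ∑ k, W i j * W i k * (z j - z k) ^ 2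

lemma spread_eq (hn : 0 < n) (z : Fin n → ℝ) :
    spread z = ∑ i, z i ^ 2 - (∑ i, z i) ^ 2 / n := by
  have hn' : (n : ℝ) ≠ 0 := by positivity
  unfold spread
  set m := ∑ j, z j
  have : ∀ i, (z i - m / n) ^ 2 = z i ^ 2 - 2 * (m / n) * z i + (m / n) ^ 2 := fun i => by ring
  simp only [this, Finset.sum_add_distrib, Finset.sum_sub_distrib, ← Finset.mul_sum]
  simp only [Finset.sum_const, Finset.card_univ, Fintype.card_fin, nsmul_eq_mul]
  change _ - 2 * (m / n) * m + _ = _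
  field_simp
  ring

lemma sum_sum_weight_mul_sub_sq (w z : Fin n → ℝ) (hw : ∑ j, w j = 1) :
    ∑ j, ∑ k, w j * w k * (z j - z k) ^ 2 =
      2 * (∑ j, w j * z j ^ 2 - (∑ j, w j * z j) ^ 2) := by
  have h1 : ∀ j k, w j * w k * (z j - z k) ^ 2 =
      (w j * z j ^ 2) * w k - 2 * ((w j * z j) * (w k * z k)) + w j * (w k * z k ^ 2) :=
    fun j k => by ring
  simp only [h1, Finset.sum_add_distrib, Finset.sum_sub_distrib, ← Finset.mul_sum,
    ← Finset.sum_mul, hw]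
  ring

lemma sum_mulVec_eq {W : Matrix (Fin n) (Fin n) ℝ} (hcol : ∀ j, ∑ i, W i j = 1)
    (z : Fin n → ℝ) : ∑ i, (W *ᵥ z) i = ∑ i, z i := by
  simp only [mulVec, dotProduct]
  rw [Finset.sum_comm]
  simp only [← Finset.sum_mul, hcol, one_mul]

lemma dissipation_eq {W : Matrix (Fin n) (Fin n) ℝ} (hrow : ∀ i, ∑ j, W i j = 1)
    (hcol : ∀ j, ∑ i, W i j = 1) (z : Fin n → ℝ) :
    dissipation W z = 2 * (∑ i, z i ^ 2 - ∑ i, (W *ᵥ z) i ^ 2) := by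
  unfold dissipation
  have h := fun i => sum_sum_weight_mul_sub_sq (W i) z (hrow i)
  simp only [h, ← Finset.mul_sum, Finset.sum_sub_distrib]
  congr 2
  rw [Finset.sum_comm]
  simp only [← Finset.sum_mul, hcol, one_mul]

lemma spread_sub_spread_mulVec {W : Matrix (Fin n) (Fin n) ℝ} (hn : 0 < n)
    (hrow : ∀ i, ∑ j, W i j = 1) (hcol : ∀ j, ∑ i, W i j = 1) (z : Fin n → ℝ) :
    spread z - spread (W *ᵥ z) = dissipation W z / 2 := by
  rw [spread_eq hn, spread_eq hn, dissipation_eq hrow hcol, sum_mulVec_eq hcol]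
  ring

lemma IsMixing.weight_nonneg {η : ℝ} {B : ℕ} {G : ℕ → Digraph (Fin n)}
    {W : ℕ → Matrix (Fin n) (Fin n) ℝ} (h : IsMixing η B G W) (hη : 0 < η) (t : ℕ)
    (i j : Fin n) : 0 ≤ W t i j := by
  by_cases ha : (G t).Adj j i
  · exact hη.le.trans (h.le_weight t i j ha)
  · exact (h.weight_eq_zero t i j ha).ge

/-- If an edge crosses the cut given by the predicate `S`, the indicator function of the cut
dissipates at least `η`. -/
lemma IsMixing.le_dissipation_indicator {η : ℝ} {B : ℕ} {G : ℕ → Digraph (Fin n)}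
    {W : ℕ → Matrix (Fin n) (Fin n) ℝ} (h : IsMixing η B G W) (hη : 0 < η) (t : ℕ)
    (S : Fin n → Prop) [DecidablePred S] {i j : Fin n} (hij : (G t).Adj j i)
    (hS : ¬ (S i ↔ S j)) :
    η ≤ dissipation (W t) (fun a => if S a then 1 else 0) := by
  have hW := h.weight_nonneg hη t
  set c : Fin n → ℝ := fun a => if S a then 1 else 0 with hc
  have hc2 : ∀ a, c a ^ 2 = c a := fun a => by simp only [hc]; split_ifs <;> norm_num
  have hc0 : ∀ a, 0 ≤ c a := fun a => by simp only [hc]; split_ifs <;> norm_num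
  have hc1 : ∀ a, c a ≤ 1 := fun a => by simp only [hc]; split_ifs <;> norm_num
  have hne : i ≠ j := fun e => hS (by rw [e])
  have key : ∀ b, ∑ j, ∑ k, W t b j * W t b k * (c j - c k) ^ 2 =
      2 * ((∑ j, W t b j * c j) * (1 - ∑ j, W t b j * c j)) := fun b => by
    rw [sum_sum_weight_mul_sub_sq (W t b) c (h.row_sum t b)]
    simp only [hc2]; ring
  have hcompl : ∀ b, 1 - ∑ j, W t b j * c j = ∑ j, W t b j * (1 - c j) := fun b => by
    simp only [mul_sub, mul_one, Finset.sum_sub_distrib, h.row_sum]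
  have hin : ∀ b a, W t b a * c a ≤ ∑ j, W t b j * c j := fun b a =>
    Finset.single_le_sum (f := fun j => W t b j * c j)
      (fun j _ => mul_nonneg (hW b j) (hc0 j)) (Finset.mem_univ a)
  have hout : ∀ b a, W t b a * (1 - c a) ≤ ∑ j, W t b j * (1 - c j) := fun b a =>
    Finset.single_le_sum (f := fun j => W t b j * (1 - c j))
      (fun j _ => mul_nonneg (hW b j) (sub_nonneg.2 (hc1 j))) (Finset.mem_univ a)
  have hterm : η ≤ 2 * ((∑ j, W t i j * c j) * (1 - ∑ j, W t i j * c j)) := by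
    have hii := h.le_weight t i i (h.self_loop t i)
    have hji := h.le_weight t i j hij
    have hbounds : η ≤ ∑ j, W t i j * c j ∧ η ≤ 1 - ∑ j, W t i j * c j := by
      rw [hcompl]
      have e1 := hin i i
      have e2 := hin i j
      have e3 := hout i i
      have e4 := hout i j
      by_cases hi : S i
      · have hj : ¬ S j := fun hj => hS ⟨fun _ => hj, fun _ => hi⟩
        simp only [hc, hi, hj, if_true, if_false] at e1 e4 ⊢
        constructor <;> linarith
      · have hj : S j := by by_contra hj; exact hS ⟨fun a => absurd a hi, fun a => absurd a hj⟩
        simp only [hc, hi, hj, if_true, if_false] at e2 e3 ⊢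
        constructor <;> linarith
    obtain ⟨h1, h2⟩ := hbounds
    nlinarith [mul_nonneg (sub_nonneg.2 h1) (sub_nonneg.2 h2)]
  unfold dissipation
  simp only [key]
  refine hterm.trans (Finset.single_le_sum
    (f := fun b => 2 * ((∑ j, W t b j * c j) * (1 - ∑ j, W t b j * c j)))
    (fun b _ => ?_) (Finset.mem_univ i))
  refine mul_nonneg zero_le_two (mul_nonneg ?_ ?_)
  · exact Finset.sum_nonneg fun j _ => mul_nonneg (hW b j) (hc0 j)
  · rw [hcompl]
    exact Finset.sum_nonneg fun j _ => mul_nonneg (hW b j) (sub_nonneg.2 (hc1 j))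

/-- Disjoint steps of a monotone sequence that lie between `r` and `r'` add up to at most
`r' - r`. -/
lemma sum_gap_sq_le {y : ℕ → ℝ} {N : ℕ} (hy : ∀ a b, a ≤ b → b < N → y a ≤ y b)
    (A : Finset ℕ) (hA : ∀ l ∈ A, l + 1 < N) {r r' : ℝ}
    (h : ∀ l ∈ A, r ≤ y l ∧ y (l + 1) ≤ r') :
    ∑ l ∈ A, (y (l + 1) - y l) ^ 2 ≤ (r' - r) ^ 2 := by
  rcases A.eq_empty_or_nonempty with rfl | hne
  · simpa using sq_nonneg _
  have hg : ∀ l ∈ A, 0 ≤ y (l + 1) - y l := fun l hl =>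
    sub_nonneg.2 (hy l (l + 1) (Nat.le_succ l) (hA l hl))
  have hsub : A ⊆ Finset.Ico (A.min' hne) (A.max' hne + 1) := fun l hl =>
    Finset.mem_Ico.2 ⟨A.min'_le l hl, Nat.lt_succ_of_le (A.le_max' l hl)⟩
  have hmm : A.min' hne ≤ A.max' hne + 1 := (A.min'_le _ (A.max'_mem hne)).trans (Nat.le_succ _)
  have hmax := hA _ (A.max'_mem hne)
  have hsum : ∑ l ∈ A, (y (l + 1) - y l) ≤ r' - r := by
    calc ∑ l ∈ A, (y (l + 1) - y l)
        ≤ ∑ l ∈ Finset.Ico (A.min' hne) (A.max' hne + 1), (y (l + 1) - y l) := by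
          refine Finset.sum_le_sum_of_subset_of_nonneg hsub fun l hl _ => ?_
          rw [Finset.mem_Ico] at hl
          exact sub_nonneg.2 (hy l (l + 1) (Nat.le_succ l) (by omega))
      _ = y (A.max' hne + 1) - y (A.min' hne) := Finset.sum_Ico_sub y hmm
      _ ≤ r' - r := sub_le_sub (h _ (A.max'_mem hne)).2 (h _ (A.min'_mem hne)).1
  calc ∑ l ∈ A, (y (l + 1) - y l) ^ 2 ≤ (∑ l ∈ A, (y (l + 1) - y l)) ^ 2 :=
        Finset.sum_sq_le_sq_sum_of_nonneg hg
    _ ≤ (r' - r) ^ 2 := pow_le_pow_left₀ (Finset.sum_nonneg hg) hsum 2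

lemma exists_sorted (z : Fin n → ℝ) : ∃ (ρ : Fin n → ℕ) (y : ℕ → ℝ),
    (∀ i, ρ i < n) ∧ (∀ l, l < n → ∃ i, ρ i = l) ∧ (∀ i, z i = y (ρ i)) ∧
    (∀ a b, a ≤ b → b < n → y a ≤ y b) := by
  let σ := Tuple.sort z
  refine ⟨fun i => (σ.symm i : ℕ), fun l => if h : l < n then z (σ ⟨l, h⟩) else 0,
    fun i => (σ.symm i).2, fun l hl => ⟨σ ⟨l, hl⟩, by simp⟩, fun i => by simp, ?_⟩
  intro a b hab hb
  have ha : a < n := hab.trans_lt hb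
  simp only [ha, hb, dif_pos]
  exact Tuple.monotone_sort z (show (⟨a, ha⟩ : Fin n) ≤ ⟨b, hb⟩ from hab)

/-- As long as no edge crosses the cut below `l`, the two sides keep to their initial ranges. -/
lemma IsMixing.separated_of_no_crossing {η : ℝ} {B : ℕ} {G : ℕ → Digraph (Fin n)}
    {W : ℕ → Matrix (Fin n) (Fin n) ℝ} (h : IsMixing η B G W) (hη : 0 < η) (k : ℕ)
    {z : ℕ → Fin n → ℝ} (hz : ∀ t, z (t + 1) = W (k + t) *ᵥ z t) {S : Fin n → Prop} {a b : ℝ}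
    (ha : ∀ i, S i → z 0 i ≤ a) (hb : ∀ i, ¬ S i → b ≤ z 0 i) (t : ℕ)
    (hcross : ∀ s < t, ∀ i j, (G (k + s)).Adj j i → (S i ↔ S j)) :
    (∀ i, S i → z t i ≤ a) ∧ ∀ i, ¬ S i → b ≤ z t i := by
  induction t with
  | zero => exact ⟨ha, hb⟩
  | succ t ih =>
    obtain ⟨h1, h2⟩ := ih fun s hs => hcross s (hs.trans (Nat.lt_succ_self t))
    have hc := hcross t (Nat.lt_succ_self t)
    have hsum : ∀ i (c : ℝ), c = ∑ j, W (k + t) i j * c := fun i c => by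
      rw [← Finset.sum_mul, h.row_sum, one_mul]
    constructor
    · intro i hi
      rw [hz, hsum i a]
      simp only [mulVec, dotProduct]
      refine Finset.sum_le_sum fun j _ => ?_
      by_cases hadj : (G (k + t)).Adj j i
      · exact mul_le_mul_of_nonneg_left (h1 j ((hc i j hadj).1 hi)) (h.weight_nonneg hη _ _ _)
      · simp [h.weight_eq_zero _ _ _ hadj]
    · intro i hi
      rw [hz, hsum i b]
      simp only [mulVec, dotProduct]
      refine Finset.sum_le_sum fun j _ => ?_
      by_cases hadj : (G (k + t)).Adj j i
      · exact mul_le_mul_of_nonneg_left (h2 j (fun hj => hi ((hc i j hadj).2 hj)))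
          (h.weight_nonneg hη _ _ _)
      · simp [h.weight_eq_zero _ _ _ hadj]

lemma exists_crossing_of_reflTransGen {ι : Type*} {r : ι → ι → Prop} {S : ι → Prop} {a b : ι}
    (hab : Relation.ReflTransGen r a b) (ha : S a) (hb : ¬ S b) :
    ∃ c d, r c d ∧ S c ∧ ¬ S d := by
  induction hab with
  | refl => exact absurd ha hb
  | @tail c d _ hcd ih =>
    by_cases hc : S c
    · exact ⟨c, d, hcd, hc, hb⟩
    · exact ih hc

lemma spread_le_sum_gap_sq (hn : 0 < n) {z : Fin n → ℝ} {ρ : Fin n → ℕ} {y : ℕ → ℝ}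
    (hρ : ∀ i, ρ i < n) (hz : ∀ i, z i = y (ρ i)) (hy : ∀ a b, a ≤ b → b < n → y a ≤ y b) :
    spread z ≤ (n : ℝ) ^ 2 * ∑ l ∈ Finset.range (n - 1), (y (l + 1) - y l) ^ 2 := by
  have hn' : (0 : ℝ) < n := by exact_mod_cast hn
  set T := ∑ l ∈ Finset.range (n - 1), (y (l + 1) - y l) ^ 2
  have hT : (y (n - 1) - y 0) ^ 2 ≤ n * T := by
    rw [← Finset.sum_range_sub]
    refine (sq_sum_le_card_mul_sum_sq (s := Finset.range (n - 1)) (f := fun l => y (l + 1) - y l)).trans ?_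
    rw [Finset.card_range]
    refine mul_le_mul_of_nonneg_right ?_ (Finset.sum_nonneg fun _ _ => sq_nonneg _)
    exact_mod_cast Nat.sub_le n 1
  have hlo : ∀ i, y 0 ≤ z i := fun i => by rw [hz]; exact hy _ _ (Nat.zero_le _) (hρ i)
  have hhi : ∀ i, z i ≤ y (n - 1) := fun i => by
    rw [hz]; exact hy _ _ (by have := hρ i; omega) (by omega)
  have hm1 : y 0 ≤ (∑ j, z j) / n := by
    rw [le_div_iff₀ hn']
    calc y 0 * n = ∑ _j : Fin n, y 0 := by simp [mul_comm]
      _ ≤ _ := Finset.sum_le_sum fun j _ => hlo j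
  have hm2 : (∑ j, z j) / n ≤ y (n - 1) := by
    rw [div_le_iff₀ hn']
    calc ∑ j, z j ≤ ∑ _j : Fin n, y (n - 1) := Finset.sum_le_sum fun j _ => hhi j
      _ = _ := by simp [mul_comm]
  unfold spread
  calc ∑ i, (z i - (∑ j, z j) / n) ^ 2 ≤ ∑ _i : Fin n, n * T := by
        refine Finset.sum_le_sum fun i _ => le_trans ?_ hT
        refine sq_le_sq' ?_ ?_ <;> linarith [hlo i, hhi i]
    _ = (n : ℝ) ^ 2 * T := by simp; ring

/-- Over a window of `B` steps the spread contracts by the factor `1 - η / (2 n²)`. -/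
theorem IsMixing.spread_window_le {η : ℝ} {B : ℕ} {G : ℕ → Digraph (Fin n)}
    {W : ℕ → Matrix (Fin n) (Fin n) ℝ} (h : IsMixing η B G W) (hη : 0 < η) (hn : 0 < n) (k : ℕ)
    {z : ℕ → Fin n → ℝ} (hz : ∀ t, z (t + 1) = W (k + t) *ᵥ z t) :
    spread (z B) ≤ (1 - η / (2 * (n : ℝ) ^ 2)) * spread (z 0) := by
  classical
  have hn' : (0 : ℝ) < n := by exact_mod_cast hn
  obtain ⟨ρ, y, hρ, hsurj, hzy, hy⟩ := exists_sorted (z 0)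
  let cross : ℕ → ℕ → Prop := fun l t =>
    ∃ i j, (G (k + t)).Adj j i ∧ ¬ (ρ i ≤ l ↔ ρ j ≤ l)
  have hex : ∀ l, l ∈ Finset.range (n - 1) → ∃ t, t < B ∧ cross l t := by
    intro l hl
    rw [Finset.mem_range] at hl
    obtain ⟨a, ha⟩ := hsurj l (by omega)
    obtain ⟨b, hb⟩ := hsurj (l + 1) (by omega)
    obtain ⟨c, d, ⟨t, ht1, ht2, hadj⟩, hc, hd⟩ := exists_crossing_of_reflTransGen
      (S := fun i => ρ i ≤ l) (h.connected k a b) (by omega) (by omega)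
    refine ⟨t - k, by omega, d, c, ?_, fun e => hd (e.2 hc)⟩
    rwa [Nat.add_sub_cancel' ht1]
  have hex' : ∀ l, ∃ t, l ∈ Finset.range (n - 1) → t < B ∧ cross l t ∧ ∀ s < t, ¬ cross l s := by
    intro l
    by_cases hl : l ∈ Finset.range (n - 1)
    · have hc : ∃ t, cross l t := (hex l hl).imp fun t ht => ht.2
      obtain ⟨t, ht, htc⟩ := hex l hl
      exact ⟨Nat.find hc, fun _ => ⟨(Nat.find_min' hc htc).trans_lt ht, Nat.find_spec hc,
        fun s hs => Nat.find_min hc hs⟩⟩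
    · exact ⟨0, fun h' => absurd h' hl⟩
  choose τ hτ using hex'
  set gap2 : ℕ → ℝ := fun l => (y (l + 1) - y l) ^ 2
  have hstep : ∀ t, η / 2 * ∑ l ∈ (Finset.range (n - 1)).filter (fun l => τ l = t), gap2 l ≤
      spread (z t) - spread (z (t + 1)) := by
    intro t
    set D := (Finset.range (n - 1)).filter (fun l => τ l = t)
    have hsep : ∀ l ∈ D, (∀ i, ρ i ≤ l → z t i ≤ y l) ∧ ∀ i, ¬ ρ i ≤ l → y (l + 1) ≤ z t i := by
      intro l hl
      obtain ⟨hl, hlt⟩ := Finset.mem_filter.1 hl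
      have hln := Finset.mem_range.1 hl
      refine h.separated_of_no_crossing hη k hz (S := fun i => ρ i ≤ l) ?_ ?_ t ?_
      · intro i hi
        rw [hzy]; exact hy _ _ hi (by omega)
      · intro i hi
        rw [hzy]; exact hy _ _ (by omega) (hρ i)
      · intro s hs i j hadj
        by_contra hne
        exact (hτ l hl).2.2 s (hlt ▸ hs) ⟨i, j, hadj, hne⟩
    rw [hz t, spread_sub_spread_mulVec hn (h.row_sum _) (h.col_sum _)]
    have hpt : ∀ i j, ∑ l ∈ D, gap2 l *
        ((if ρ i ≤ l then (1 : ℝ) else 0) - if ρ j ≤ l then 1 else 0) ^ 2 ≤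
        (z t i - z t j) ^ 2 := by
      have main : ∀ i j, ρ i ≤ ρ j → ∑ l ∈ D, gap2 l *
        ((if ρ i ≤ l then (1 : ℝ) else 0) - if ρ j ≤ l then 1 else 0) ^ 2 ≤
        (z t i - z t j) ^ 2 := by
        intro i j hij
        calc _ = ∑ l ∈ D, if ρ i ≤ l ∧ ¬ ρ j ≤ l then gap2 l else 0 := by
              refine Finset.sum_congr rfl fun l _ => ?_
              by_cases h1 : ρ i ≤ l <;> by_cases h2 : ρ j ≤ l <;> simp [h1, h2]
              omega
          _ = ∑ l ∈ D.filter (fun l => ρ i ≤ l ∧ ¬ ρ j ≤ l), gap2 l :=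
              (Finset.sum_filter _ _).symm
          _ ≤ (z t j - z t i) ^ 2 := by
              refine sum_gap_sq_le (N := n) hy _ ?_ ?_
              · intro l hl
                have := Finset.mem_range.1 (Finset.mem_filter.1 (Finset.mem_filter.1 hl).1).1
                omega
              · intro l hl
                obtain ⟨hl, h1, h2⟩ := Finset.mem_filter.1 hl
                exact ⟨(hsep l hl).1 i h1, (hsep l hl).2 j h2⟩
          _ = _ := by ring
      intro i j
      rcases le_total (ρ i) (ρ j) with hij | hij
      · exact main i j hij
      · calc _ = ∑ l ∈ D, gap2 l *
              ((if ρ j ≤ l then (1 : ℝ) else 0) - if ρ i ≤ l then 1 else 0) ^ 2 :=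
              Finset.sum_congr rfl fun l _ => by ring
          _ ≤ _ := main j i hij
          _ = _ := by ring
    have hdis : ∑ l ∈ D, gap2 l * dissipation (W (k + t)) (fun i => if ρ i ≤ l then 1 else 0) ≤
        dissipation (W (k + t)) (z t) := by
      unfold dissipation
      simp only [Finset.mul_sum]
      rw [Finset.sum_comm]
      refine Finset.sum_le_sum fun i _ => ?_
      rw [Finset.sum_comm]
      refine Finset.sum_le_sum fun a _ => ?_
      rw [Finset.sum_comm]
      refine Finset.sum_le_sum fun b _ => ?_
      calc _ = W (k + t) i a * W (k + t) i b * ∑ l ∈ D, gap2 l *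
            ((if ρ a ≤ l then (1 : ℝ) else 0) - if ρ b ≤ l then 1 else 0) ^ 2 := by
            rw [Finset.mul_sum]
            exact Finset.sum_congr rfl fun l _ => by ring
        _ ≤ _ := mul_le_mul_of_nonneg_left (hpt a b)
            (mul_nonneg (h.weight_nonneg hη _ _ _) (h.weight_nonneg hη _ _ _))
    have hcut : ∑ l ∈ D, gap2 l * η ≤ ∑ l ∈ D, gap2 l *
        dissipation (W (k + t)) (fun i => if ρ i ≤ l then 1 else 0) := by
      refine Finset.sum_le_sum fun l hl => mul_le_mul_of_nonneg_left ?_ (sq_nonneg _)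
      obtain ⟨hl, hlt⟩ := Finset.mem_filter.1 hl
      obtain ⟨i, j, hadj, hne⟩ := (hτ l hl).2.1
      rw [hlt] at hadj
      exact h.le_dissipation_indicator hη (k + t) (fun i => ρ i ≤ l) hadj hne
    rw [← Finset.sum_mul] at hcut
    linarith
  have htotal : η / 2 * ∑ l ∈ Finset.range (n - 1), gap2 l ≤ spread (z 0) - spread (z B) := by
    rw [← Finset.sum_range_sub' (fun t => spread (z t)) B,
      ← Finset.sum_fiberwise_of_maps_to (s := Finset.range (n - 1)) (t := Finset.range B) (g := τ)
        (fun l hl => Finset.mem_range.2 (hτ l hl).1), Finset.mul_sum]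
    exact Finset.sum_le_sum fun t _ => hstep t
  have hsp := spread_le_sum_gap_sq hn hρ hzy hy
  have : η / (2 * (n : ℝ) ^ 2) * spread (z 0) ≤
      η / 2 * ∑ l ∈ Finset.range (n - 1), gap2 l := by
    calc η / (2 * (n : ℝ) ^ 2) * spread (z 0) ≤ η / (2 * (n : ℝ) ^ 2) *
          ((n : ℝ) ^ 2 * ∑ l ∈ Finset.range (n - 1), (y (l + 1) - y l) ^ 2) :=
          mul_le_mul_of_nonneg_left hsp (by positivity)
      _ = _ := by field_simp; rfl
  linarith

/-- The contraction factor `1 - η / (4 n²)`. -/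
def rate (η : ℝ) (n : ℕ) : ℝ := 1 - η / (4 * (n : ℝ) ^ 2)

lemma rate_pos {η : ℝ} (hη1 : η < 1) (hn : 0 < n) : 0 < rate η n := by
  have hn' : (1 : ℝ) ≤ n := by exact_mod_cast hn
  unfold rate
  rw [sub_pos, div_lt_one (by positivity)]
  nlinarith

lemma rate_lt_one {η : ℝ} (hη : 0 < η) (hn : 0 < n) : rate η n < 1 := by
  have hn' : (0 : ℝ) < n := by exact_mod_cast hn
  unfold rate
  have : 0 < η / (4 * (n : ℝ) ^ 2) := by positivity
  linarith

lemma spread_nonneg (z : Fin n → ℝ) : 0 ≤ spread z := Finset.sum_nonneg fun _ _ => sq_nonneg _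

lemma IsMixing.spread_antitone {η : ℝ} {B : ℕ} {G : ℕ → Digraph (Fin n)}
    {W : ℕ → Matrix (Fin n) (Fin n) ℝ} (h : IsMixing η B G W) (hη : 0 < η) (hn : 0 < n) (k : ℕ)
    {z : ℕ → Fin n → ℝ} (hz : ∀ t, z (t + 1) = W (k + t) *ᵥ z t) :
    Antitone fun t => spread (z t) := by
  refine antitone_nat_of_succ_le fun t => ?_
  have := spread_sub_spread_mulVec hn (h.row_sum (k + t)) (h.col_sum (k + t)) (z t)
  rw [← hz t] at this
  have h0 : 0 ≤ dissipation (W (k + t)) (z t) :=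
    Finset.sum_nonneg fun i _ => Finset.sum_nonneg fun a _ => Finset.sum_nonneg fun b _ =>
      mul_nonneg (mul_nonneg (h.weight_nonneg hη _ _ _) (h.weight_nonneg hη _ _ _)) (sq_nonneg _)
  linarith

lemma IsMixing.spread_mul_le {η : ℝ} {B : ℕ} {G : ℕ → Digraph (Fin n)}
    {W : ℕ → Matrix (Fin n) (Fin n) ℝ} (h : IsMixing η B G W) (hη : 0 < η) (hn : 0 < n) (k : ℕ)
    {z : ℕ → Fin n → ℝ} (hz : ∀ t, z (t + 1) = W (k + t) *ᵥ z t) (q : ℕ) :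
    spread (z (q * B)) ≤ (rate η n ^ q) ^ 2 * spread (z 0) := by
  induction q with
  | zero => simp
  | succ q ih =>
    have hw := h.spread_window_le hη hn (k + q * B) (z := fun t => z (q * B + t))
      (fun t => by rw [add_assoc k]; exact hz (q * B + t))
    have hr : 1 - η / (2 * (n : ℝ) ^ 2) ≤ rate η n ^ 2 := by
      have e : η / (2 * (n : ℝ) ^ 2) = 2 * (η / (4 * (n : ℝ) ^ 2)) := by
        field_simp; norm_num
      unfold rate
      rw [e]
      nlinarith [sq_nonneg (η / (4 * (n : ℝ) ^ 2))]
    calc spread (z ((q + 1) * B)) = spread (z (q * B + B)) := by rw [add_mul, one_mul]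
      _ ≤ (1 - η / (2 * (n : ℝ) ^ 2)) * spread (z (q * B)) := hw
      _ ≤ rate η n ^ 2 * spread (z (q * B)) :=
          mul_le_mul_of_nonneg_right hr (spread_nonneg _)
      _ ≤ rate η n ^ 2 * ((rate η n ^ q) ^ 2 * spread (z 0)) :=
          mul_le_mul_of_nonneg_left ih (sq_nonneg _)
      _ = _ := by ring

lemma theta_pos {η : ℝ} {B : ℕ} (hη1 : η < 1) (hn : 0 < n) : 0 < theta η n B :=
  Real.rpow_pos_of_pos (rate_pos hη1 hn) _

lemma theta_lt_one {η : ℝ} {B : ℕ} (hη : 0 < η) (hη1 : η < 1) (hn : 0 < n) (hB : 1 ≤ B) :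
    theta η n B < 1 :=
  Real.rpow_lt_one (rate_pos hη1 hn).le (rate_lt_one hη hn)
    (by have : (0 : ℝ) < B := by exact_mod_cast hB
        positivity)

lemma rate_pow_div_le {η : ℝ} {B : ℕ} (hη : 0 < η) (hη1 : η < 1) (hn : 0 < n) (hB : 1 ≤ B)
    (m : ℕ) : rate η n ^ (m / B) ≤ Gam η n * theta η n B ^ m := by
  have hr := rate_pos hη1 hn
  have hr1 := rate_lt_one hη hn
  have hB' : (0 : ℝ) < B := by exact_mod_cast hB
  have h1 : Gam η n * theta η n B ^ m = rate η n ^ ((m : ℝ) / B - 2) := by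
    have : theta η n B = rate η n ^ (1 / (B : ℝ)) := rfl
    rw [this, ← Real.rpow_natCast, ← Real.rpow_mul hr.le, Real.rpow_sub hr]
    have e : Gam η n = (rate η n ^ 2)⁻¹ := rfl
    rw [e, ← Real.rpow_natCast (rate η n) 2]
    push_cast
    rw [mul_comm, div_eq_mul_inv]
    congr 2
    ring
  rw [h1, ← Real.rpow_natCast]
  refine Real.rpow_le_rpow_of_exponent_ge hr hr1.le ?_
  have : m < (m / B + 1) * B := by
    have := Nat.lt_div_mul_add (a := m) (b := B) (by omega)
    rw [add_mul, one_mul]; exact this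
  have h2 : (m : ℝ) < ((m / B : ℕ) + 1) * B := by exact_mod_cast this
  have h3 : (m : ℝ) / B < (m / B : ℕ) + 1 := by rwa [div_lt_iff₀ hB']
  linarith

/-- The product `W(s + m - 1) ⋯ W(s)`. -/
def transition (W : ℕ → Matrix (Fin n) (Fin n) ℝ) (s : ℕ) : ℕ → Matrix (Fin n) (Fin n) ℝ
  | 0 => 1
  | m + 1 => W (s + m) * transition W s m

theorem IsMixing.abs_transition_sub_le {η : ℝ} {B : ℕ} {G : ℕ → Digraph (Fin n)}
    {W : ℕ → Matrix (Fin n) (Fin n) ℝ} (h : IsMixing η B G W) (hη : 0 < η) (hη1 : η < 1)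
    (s m : ℕ) (i j : Fin n) :
    |transition W s m i j - 1 / n| ≤ Gam η n * theta η n B ^ m := by
  have hn : 0 < n := i.pos
  refine le_trans ?_ (rate_pow_div_le hη hη1 hn h.one_le m)
  set z : ℕ → Fin n → ℝ := fun m a => transition W s m a j with hzdef
  have hz : ∀ t, z (t + 1) = W (s + t) *ᵥ z t := fun t => by
    ext a; simp [hzdef, transition, mul_apply, mulVec, dotProduct]
  have hsum : ∀ t, ∑ a, z t a = 1 := by
    intro t
    induction t with
    | zero => simp [hzdef, transition, one_apply]
    | succ t ih => rw [hz, sum_mulVec_eq (h.col_sum _), ih]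
  have h0 : spread (z 0) ≤ 1 := by
    rw [spread_eq hn, hsum]
    have : ∑ a, z 0 a ^ 2 = 1 := by simp [hzdef, transition, one_apply]
    rw [this]
    have : (0 : ℝ) ≤ 1 ^ 2 / n := by positivity
    linarith
  refine abs_le_of_sq_le_sq ?_ (pow_nonneg (rate_pos hη1 hn).le _)
  calc (transition W s m i j - 1 / n) ^ 2 = (z m i - (∑ a, z m a) / n) ^ 2 := by rw [hsum]
    _ ≤ spread (z m) := Finset.single_le_sum (f := fun i => (z m i - (∑ a, z m a) / n) ^ 2)
        (fun _ _ => sq_nonneg _) (Finset.mem_univ i)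
    _ ≤ spread (z (m / B * B)) := h.spread_antitone hη hn s hz (Nat.div_mul_le_self m B)
    _ ≤ (rate η n ^ (m / B)) ^ 2 * spread (z 0) := h.spread_mul_le hη hn s hz _
    _ ≤ (rate η n ^ (m / B)) ^ 2 * 1 := mul_le_mul_of_nonneg_left h0 (sq_nonneg _)
    _ = _ := mul_one _

end Mixing

section Bregman

variable {E : Type*} [NormedAddCommGroup E] [NormedSpace ℝ E] {X : Set E} {ψ : E → ℝ}

lemma tendsto_inv_add_one : Tendsto (fun k : ℕ => ((k : ℝ) + 1)⁻¹) atTop (𝓝 0) := by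
  simpa only [one_div] using tendsto_one_div_add_atTop_nhds_zero_nat (𝕜 := ℝ)

lemma inv_add_one_mem (k : ℕ) : 0 < ((k : ℝ) + 1)⁻¹ ∧ ((k : ℝ) + 1)⁻¹ ≤ 1 :=
  ⟨by positivity, inv_le_one_of_one_le₀ (by linarith [(Nat.cast_nonneg k : (0 : ℝ) ≤ k)])⟩

lemma add_smul_sub_mem_of_convex (hX : Convex ℝ X) {p x : E} (hp : p ∈ X) (hx : x ∈ X) (k : ℕ) :
    p + ((k : ℝ) + 1)⁻¹ • (x - p) ∈ X :=
  hX.add_smul_sub_mem hp hx ⟨(inv_add_one_mem k).1.le, (inv_add_one_mem k).2⟩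

/-- The derivative within a convex set in a feasible direction is the limit of the difference
quotients. -/
lemma tendsto_slope_fderivWithin (hX : Convex ℝ X) (hψ : DifferentiableOn ℝ ψ X) {p x : E}
    (hp : p ∈ X) (hx : x ∈ X) :
    Tendsto (fun k : ℕ => ((k : ℝ) + 1) * (ψ (p + ((k : ℝ) + 1)⁻¹ • (x - p)) - ψ p)) atTop
      (𝓝 (fderivWithin ℝ ψ X p (x - p))) := by
  refine (hψ p hp).hasFDerivWithinAt.lim (c := fun k : ℕ => (k : ℝ) + 1)
    (d := fun k : ℕ => ((k : ℝ) + 1)⁻¹ • (x - p)) ?_ ?_ ?_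
  · simpa using tendsto_inv_add_one.smul_const (x - p)
  · exact Eventually.of_forall (add_smul_sub_mem_of_convex hX hp hx)
  · refine tendsto_const_nhds.congr fun k => ?_
    rw [smul_inv_smul₀]
    positivity

/-- A strongly convex function grows quadratically away from its minimizer. -/
lemma _root_.StrongConvexOn.add_sq_le_of_isMinOn {f : E → ℝ} (hf : StrongConvexOn X 1 f) {q x : E}
    (hq : q ∈ X) (hx : x ∈ X) (hmin : ∀ z ∈ X, f q ≤ f z) :
    f q + 1 / 2 * ‖x - q‖ ^ 2 ≤ f x := by
  have key : ∀ k : ℕ, f q + (1 - ((k : ℝ) + 1)⁻¹) * (1 / 2 * ‖x - q‖ ^ 2) ≤ f x := by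
    intro k
    obtain ⟨h0, h1⟩ := inv_add_one_mem k
    set a := ((k : ℝ) + 1)⁻¹
    have hab : a + (1 - a) = 1 := by ring
    have h := hf.2 hx hq h0.le (sub_nonneg.2 h1) hab
    have h2 := hmin _ (hf.1 hx hq h0.le (sub_nonneg.2 h1) hab)
    simp only [smul_eq_mul] at h
    have h3 : a * (f q + (1 - a) * (1 / 2 * ‖x - q‖ ^ 2)) ≤ a * f x := by linarith
    exact le_of_mul_le_mul_left h3 h0
  have hlim : Tendsto (fun k : ℕ => f q + (1 - ((k : ℝ) + 1)⁻¹) * (1 / 2 * ‖x - q‖ ^ 2)) atTop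
      (𝓝 (f q + (1 - 0) * (1 / 2 * ‖x - q‖ ^ 2))) :=
    (((tendsto_const_nhds.sub tendsto_inv_add_one).mul_const _).const_add _)
  rw [sub_zero, one_mul] at hlim
  exact le_of_tendsto' hlim key

lemma _root_.StrongConvexOn.add_clm_const {f : E → ℝ} (hf : StrongConvexOn X 1 f)
    (A : StrongDual ℝ E) (c : ℝ) : StrongConvexOn X 1 (fun x => f x + A x + c) := by
  refine ⟨hf.1, fun x hx y hy a b ha hb hab => ?_⟩
  have h := hf.2 hx hy ha hb hab
  simp only [map_add, map_smul, smul_eq_mul] at h ⊢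
  have : c = a * c + b * c := by rw [← add_mul, hab, one_mul]
  linarith

@[simp] lemma bregman_self (X : Set E) (ψ : E → ℝ) (p : E) : bregman X ψ p p = 0 := by
  simp [bregman]

namespace IsRegularizer


lemma strongConvexOn_bregman (h : IsRegularizer X ψ) (p : E) : StrongConvexOn X 1 (fun x => bregman X ψ x p) := by
  have := h.strongConvexOn.add_clm_const (-fderivWithin ℝ ψ X p)
    (-ψ p + fderivWithin ℝ ψ X p p)
  convert this using 2 with x
  simp only [bregman, map_sub, neg_apply]
  ring

lemma continuousOn_bregman (h : IsRegularizer X ψ) (p : E) : ContinuousOn (fun x => bregman X ψ x p) X :=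
  ((h.differentiableOn.continuousOn.sub continuousOn_const).sub
    ((fderivWithin ℝ ψ X p).continuous.comp
      (continuous_id.sub continuous_const)).continuousOn)

lemma sq_le_bregman (h : IsRegularizer X ψ) {x p : E} (hx : x ∈ X) (hp : p ∈ X) :
    1 / 2 * ‖x - p‖ ^ 2 ≤ bregman X ψ x p := by
  have hX : Convex ℝ X := h.strongConvexOn.1
  have key : ∀ k : ℕ, ((k : ℝ) + 1) * (ψ (p + ((k : ℝ) + 1)⁻¹ • (x - p)) - ψ p) ≤
      ψ x - ψ p - (1 - ((k : ℝ) + 1)⁻¹) * (1 / 2 * ‖x - p‖ ^ 2) := by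
    intro k
    obtain ⟨h0, h1⟩ := inv_add_one_mem k
    have hk : ((k : ℝ) + 1) = (((k : ℝ) + 1)⁻¹)⁻¹ := (inv_inv _).symm
    rw [hk, inv_inv (((k : ℝ) + 1))]
    set a := ((k : ℝ) + 1)⁻¹
    rw [hk]
    have hab : a + (1 - a) = 1 := by ring
    have h2 := h.strongConvexOn.2 hx hp h0.le (sub_nonneg.2 h1) hab
    have e : a • x + (1 - a) • p = p + a • (x - p) := by
      rw [sub_smul, one_smul, smul_sub]; abel
    rw [e] at h2
    simp only [smul_eq_mul] at h2
    rw [inv_mul_le_iff₀ h0]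
    linarith
  have hlim : Tendsto (fun k : ℕ => ψ x - ψ p - (1 - ((k : ℝ) + 1)⁻¹) * (1 / 2 * ‖x - p‖ ^ 2))
      atTop (𝓝 (ψ x - ψ p - (1 - 0) * (1 / 2 * ‖x - p‖ ^ 2))) :=
    (((tendsto_const_nhds.sub tendsto_inv_add_one).mul_const _).const_sub _)
  have := le_of_tendsto_of_tendsto' (tendsto_slope_fderivWithin hX h.differentiableOn hp hx) hlim
    key
  unfold bregman
  linarith

lemma bregman_nonneg (h : IsRegularizer X ψ) {x p : E} (hx : x ∈ X) (hp : p ∈ X) : 0 ≤ bregman X ψ x p :=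
  le_trans (by positivity) (h.sq_le_bregman hx hp)

lemma bregman_le (h : IsRegularizer X ψ) {x p : E} (hx : x ∈ X) (hp : p ∈ X) : bregman X ψ x p ≤ bregmanDiamSq X ψ :=
  le_csSup h.bddAbove ⟨x, hx, p, hp, rfl⟩

/-- The three-point inequality of the prox-mapping. -/
lemma three_point (h : IsRegularizer X ψ) {p q x : E} {y : StrongDual ℝ E} (hq : IsProx X ψ p y q)
    (hx : x ∈ X) :
    y (x - q) ≤ bregman X ψ x p - bregman X ψ x q - bregman X ψ q p := by
  have hX : Convex ℝ X := h.strongConvexOn.1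
  have key : ∀ k : ℕ, y (x - q) + fderivWithin ℝ ψ X p (x - q) ≤
      ((k : ℝ) + 1) * (ψ (q + ((k : ℝ) + 1)⁻¹ • (x - q)) - ψ q) := by
    intro k
    have h1 := hq.2 _ (add_smul_sub_mem_of_convex hX hq.1 hx k)
    have h0 : (0 : ℝ) < (k : ℝ) + 1 := by positivity
    rw [← div_le_iff₀' h0, div_eq_inv_mul]
    simp only [bregman, map_sub, map_add, map_smul, smul_eq_mul] at h1 ⊢
    linarith
  have := ge_of_tendsto' (tendsto_slope_fderivWithin hX h.differentiableOn hq.1 hx) key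
  simp only [bregman, map_sub] at this ⊢
  linarith

lemma norm_prox_sub_le (h : IsRegularizer X ψ) {p q : E} {y : StrongDual ℝ E} (hp : p ∈ X) (hq : IsProx X ψ p y q) :
    ‖q - p‖ ≤ ‖y‖ := by
  have h1 := h.three_point hq hp
  have h2 := h.sq_le_bregman hp hq.1
  have h3 := h.sq_le_bregman hq.1 hp
  rw [bregman_self] at h1
  rw [norm_sub_rev] at h2
  have h4 : y (q - p) ≤ ‖y‖ * ‖q - p‖ := (le_abs_self _).trans (y.le_opNorm _)
  have h5 : y (p - q) = - y (q - p) := by rw [← map_neg, neg_sub]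
  have h6 : ‖q - p‖ * ‖q - p‖ ≤ ‖y‖ * ‖q - p‖ := by nlinarith
  by_contra hlt
  push Not at hlt
  have : 0 < ‖q - p‖ := (norm_nonneg _).trans_lt hlt
  exact absurd (le_of_mul_le_mul_right h6 this) (not_le.2 hlt)

/-- One step of mirror descent with step size `a` and subgradient estimate `g`. -/
lemma mirror_step (h : IsRegularizer X ψ) {p q x : E} {g : StrongDual ℝ E} {a : ℝ} (hp : p ∈ X)
    (hq : IsProx X ψ p (-(a • g)) q) (hx : x ∈ X) :
    a * g (p - x) ≤ bregman X ψ x p - bregman X ψ x q + 1 / 2 * (a * ‖g‖) ^ 2 := by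
  have h1 := h.three_point hq hx
  have h2 := h.sq_le_bregman hq.1 hp
  have h3 : a * g (p - q) ≤ |a| * ‖g‖ * ‖q - p‖ := by
    calc a * g (p - q) ≤ |a * g (p - q)| := le_abs_self _
      _ = |a| * ‖g (p - q)‖ := by rw [abs_mul, Real.norm_eq_abs]
      _ ≤ |a| * (‖g‖ * ‖p - q‖) := mul_le_mul_of_nonneg_left (g.le_opNorm _) (abs_nonneg _)
      _ = _ := by rw [norm_sub_rev, mul_assoc]
  have h4 : |a| * ‖g‖ * ‖q - p‖ ≤ 1 / 2 * (a * ‖g‖) ^ 2 + 1 / 2 * ‖q - p‖ ^ 2 := by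
    have e : (a * ‖g‖) ^ 2 = (|a| * ‖g‖) ^ 2 := by rw [mul_pow, mul_pow, sq_abs]
    rw [e]
    nlinarith [sq_nonneg (|a| * ‖g‖ - ‖q - p‖)]
  simp only [neg_apply, smul_apply, smul_eq_mul,
    map_sub] at h1 h3 ⊢
  linarith

/-- The mirror map of the regularizer `D(·, x₀)`: the maximizer of `S x - D(x, x₀)` on `X`. -/
lemma exists_mirrorMap (h : IsRegularizer X ψ) (hXc : IsCompact X) {x₀ : E} (hx₀ : x₀ ∈ X) :
    ∃ π : StrongDual ℝ E → E, (∀ S, π S ∈ X) ∧ Continuous π ∧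
      ∀ S, ∀ x ∈ X, S x - bregman X ψ x x₀ + 1 / 2 * ‖x - π S‖ ^ 2 ≤
        S (π S) - bregman X ψ (π S) x₀ := by
  have hex : ∀ S : StrongDual ℝ E, ∃ q ∈ X, ∀ z ∈ X,
      bregman X ψ q x₀ + (-S) q + 0 ≤ bregman X ψ z x₀ + (-S) z + 0 := fun S =>
    hXc.exists_isMinOn ⟨x₀, hx₀⟩
      (((h.continuousOn_bregman x₀).add (-S).continuous.continuousOn).add continuousOn_const)
  choose π hπ hmin using hex
  have hineq : ∀ S, ∀ x ∈ X, S x - bregman X ψ x x₀ + 1 / 2 * ‖x - π S‖ ^ 2 ≤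
        S (π S) - bregman X ψ (π S) x₀ := by
    intro S x hx
    have := ((h.strongConvexOn_bregman x₀).add_clm_const (-S) 0).add_sq_le_of_isMinOn
      (hπ S) hx (hmin S)
    simp only [neg_apply] at this
    linarith
  refine ⟨π, hπ, ?_, hineq⟩
  refine (LipschitzWith.of_dist_le_mul (K := 1) fun S T => ?_).continuous
  rw [dist_eq_norm, dist_eq_norm, NNReal.coe_one, one_mul]
  have h1 := hineq S (π T) (hπ T)
  have h2 := hineq T (π S) (hπ S)
  rw [norm_sub_rev] at h1
  have h3 : (S - T) (π S - π T) ≤ ‖S - T‖ * ‖π S - π T‖ :=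
    (le_abs_self _).trans ((S - T).le_opNorm _)
  simp only [sub_apply, map_sub] at h3
  have h6 : ‖π S - π T‖ * ‖π S - π T‖ ≤ ‖S - T‖ * ‖π S - π T‖ := by nlinarith
  by_contra hlt
  push Not at hlt
  have : 0 < ‖π S - π T‖ := (norm_nonneg _).trans_lt hlt
  exact absurd (le_of_mul_le_mul_right h6 this) (not_le.2 hlt)


/-- The regret of dual averaging against linear gains `y_t`. -/
lemma dual_averaging_regret {π : StrongDual ℝ E → E} {x₀ : E} (hπ : ∀ S, π S ∈ X)
    (hD : ∀ x ∈ X, 0 ≤ bregman X ψ x x₀)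
    (hmax : ∀ S, ∀ x ∈ X, S x - bregman X ψ x x₀ + 1 / 2 * ‖x - π S‖ ^ 2 ≤
        S (π S) - bregman X ψ (π S) x₀) (y : ℕ → StrongDual ℝ E) (T : ℕ) {x : E} (hx : x ∈ X) :
    ∑ t ∈ Finset.range T, y t (x - π (∑ s ∈ Finset.range t, y s)) ≤
      bregman X ψ x x₀ + ∑ t ∈ Finset.range T, 1 / 2 * ‖y t‖ ^ 2 := by
  have key : ∀ T, ∀ x ∈ X, (∑ s ∈ Finset.range T, y s) x - bregman X ψ x x₀ ≤
      ∑ t ∈ Finset.range T, (y t (π (∑ s ∈ Finset.range t, y s)) + 1 / 2 * ‖y t‖ ^ 2) := by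
    intro T
    induction T with
    | zero => intro x hx; simpa using hD x hx
    | succ T ih =>
      intro x hx
      rw [Finset.sum_range_succ, Finset.sum_range_succ (fun t => y t _ + _)]
      set S := ∑ s ∈ Finset.range T, y s
      have h1 := hmax S x hx
      have h2 := ih (π S) (hπ S)
      have h3 : y T (x - π S) ≤ ‖y T‖ * ‖x - π S‖ := (le_abs_self _).trans ((y T).le_opNorm _)
      rw [add_apply]
      rw [map_sub] at h3
      nlinarith [sq_nonneg (‖y T‖ - ‖x - π S‖)]
  have h1 := key T x hx
  simp only [map_sub, Finset.sum_sub_distrib, Finset.sum_add_distrib,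
    sum_apply] at h1 ⊢
  linarith

end IsRegularizer

end Bregman

section Measurability

variable {Ω E : Type*} [NormedAddCommGroup E] {X : Set E} {ψ : E → ℝ} {m : MeasurableSpace Ω}

lemma stronglyMeasurable_dual_apply [NormedSpace ℝ E] {A : Ω → StrongDual ℝ E} {v : Ω → E}
    (hA : StronglyMeasurable A) (hv : StronglyMeasurable v) :
    StronglyMeasurable fun ω => A ω (v ω) :=
  (isBoundedBilinearMap_apply (𝕜 := ℝ) (E := E) (F := ℝ)).continuous.comp_stronglyMeasurable
    (hA.prodMk hv)

variable [MeasurableSpace E] [BorelSpace E]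

lemma _root_.ContinuousOn.measurable_comp_of_mem {f : E → ℝ} (hf : ContinuousOn f X) {v : Ω → E}
    (hv : Measurable v) (hvX : ∀ ω, v ω ∈ X) : Measurable fun ω => f (v ω) :=
  (continuousOn_iff_continuous_domRestrict.1 hf).measurable.comp (hv.subtype_mk (h := hvX))

/-- The minimizer over `X` of a function with quadratic growth, which depends measurably on a
parameter, is a measurable function of the parameter. -/
lemma measurable_argmin [SecondCountableTopology E] {φ : Ω → E → ℝ}
    (hφm : ∀ x ∈ X, Measurable fun ω => φ ω x) (hφc : ∀ ω, ContinuousOn (φ ω) X) {q : Ω → E}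
    (hq : ∀ ω, q ω ∈ X)
    (hmin : ∀ ω, ∀ x ∈ X, φ ω (q ω) + 1 / 2 * ‖x - q ω‖ ^ 2 ≤ φ ω x) : Measurable q := by
  rcases isEmpty_or_nonempty Ω with hΩ | ⟨⟨ω₀⟩⟩
  · exact measurable_of_empty q
  have : Nonempty X := ⟨⟨q ω₀, hq ω₀⟩⟩
  obtain ⟨d, hd⟩ := TopologicalSpace.exists_dense_seq X
  have happrox : ∀ ω (ε : ℝ), 0 < ε → ∃ k, dist (d k : E) (q ω) < ε ∧
      φ ω (d k) < φ ω (q ω) + ε := by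
    intro ω ε hε
    have hc : Continuous fun x : X => φ ω x := continuousOn_iff_continuous_domRestrict.1 (hφc ω)
    have hopen : IsOpen {x : X | dist (x : E) (q ω) < ε ∧ φ ω x < φ ω (q ω) + ε} :=
      (isOpen_lt (continuous_subtype_val.dist continuous_const) continuous_const).inter
        (isOpen_lt hc continuous_const)
    obtain ⟨k, hk⟩ := hd.exists_mem_open hopen ⟨⟨q ω, hq ω⟩, by simpa using hε⟩
    exact ⟨k, hk⟩
  refine measurable_of_isClosed' fun F hF hFne _ => ?_
  have heq : q ⁻¹' F = ⋂ m : ℕ, ⋃ k : ℕ, {ω | Metric.infDist (d k : E) F < 1 / ((m : ℝ) + 1) ∧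
      ∀ j, φ ω (d k) ≤ φ ω (d j) + 1 / ((m : ℝ) + 1)} := by
    ext ω
    simp only [mem_preimage, mem_iInter, mem_iUnion, mem_ofPred_eq]
    constructor
    · intro hqF m
      obtain ⟨k, hk1, hk2⟩ := happrox ω (1 / ((m : ℝ) + 1)) (by positivity)
      refine ⟨k, (Metric.infDist_le_dist_of_mem hqF).trans_lt hk1, fun j => ?_⟩
      have := hmin ω (d j) (d j).2
      nlinarith [sq_nonneg ‖(d j : E) - q ω‖]
    · intro hall
      rw [hF.mem_iff_infDist_zero hFne]
      by_contra hne
      have hr : 0 < Metric.infDist (q ω) F := lt_of_le_of_ne Metric.infDist_nonneg (Ne.symm hne)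
      set r := Metric.infDist (q ω) F
      obtain ⟨m, hm⟩ := exists_nat_one_div_lt (K := ℝ) (ε := min (r / 2) (r ^ 2 / 16))
        (by positivity)
      obtain ⟨k, hk1, hk2⟩ := hall m
      set ε := 1 / ((m : ℝ) + 1)
      obtain ⟨j, -, hj⟩ := happrox ω ε (by positivity)
      have h1 := hmin ω (d k) (d k).2
      have h2 := hk2 j
      have h3 : r ≤ Metric.infDist (d k : E) F + dist (q ω) (d k) :=
        Metric.infDist_le_infDist_add_dist
      rw [dist_comm, dist_eq_norm] at h3
      have h4 := hm.trans_le (min_le_left _ _)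
      have h5 := hm.trans_le (min_le_right _ _)
      have h6 : ‖(d k : E) - q ω‖ < r / 2 := by
        refine lt_of_pow_lt_pow_left₀ 2 (by positivity) ?_
        nlinarith
      linarith
  rw [heq]
  refine MeasurableSet.iInter fun m => MeasurableSet.iUnion fun k => ?_
  have hj : MeasurableSet (⋂ j, {ω | φ ω (d k) ≤ φ ω (d j) + 1 / ((m : ℝ) + 1)}) :=
    MeasurableSet.iInter fun j =>
      measurableSet_le (hφm _ (d k).2) ((hφm _ (d j).2).add_const _)
  convert (MeasurableSet.const (Metric.infDist (d k : E) F < 1 / ((m : ℝ) + 1))).inter hj using 1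
  ext ω
  simp

variable [NormedSpace ℝ E] [FiniteDimensional ℝ E]

lemma IsRegularizer.measurable_bregman_right (h : IsRegularizer X ψ) {v : Ω → E}
    (hv : Measurable v) (hvX : ∀ ω, v ω ∈ X) {x : E} (hx : x ∈ X) :
    Measurable fun ω => bregman X ψ x (v ω) := by
  have : ProperSpace E := FiniteDimensional.proper ℝ E
  have hc := h.differentiableOn.continuousOn
  have hX : Convex ℝ X := h.strongConvexOn.1
  have hψ : Measurable fun ω => ψ (v ω) := hc.measurable_comp_of_mem hv hvX
  have hd : Measurable fun ω => fderivWithin ℝ ψ X (v ω) (x - v ω) := by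
    refine measurable_of_tendsto_metrizable (f := fun (k : ℕ) ω =>
      ((k : ℝ) + 1) * (ψ (v ω + ((k : ℝ) + 1)⁻¹ • (x - v ω)) - ψ (v ω))) (fun k => ?_)
      (tendsto_pi_nhds.2 fun ω =>
        tendsto_slope_fderivWithin hX h.differentiableOn (hvX ω) hx)
    refine ((hc.measurable_comp_of_mem ?_ fun ω =>
      add_smul_sub_mem_of_convex hX (hvX ω) hx k).sub hψ).const_mul _
    exact hv.add ((measurable_const.sub hv).const_smul _)
  exact (measurable_const.sub hψ).sub hd

/-- The prox-mapping preserves measurability. -/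
lemma IsRegularizer.measurable_prox (h : IsRegularizer X ψ)
    {v q : Ω → E} {y : Ω → StrongDual ℝ E} (hv : Measurable v) (hvX : ∀ ω, v ω ∈ X)
    (hy : StronglyMeasurable y) (hq : ∀ ω, IsProx X ψ (v ω) (y ω) (q ω)) : Measurable q := by
  have : ProperSpace E := FiniteDimensional.proper ℝ E
  refine measurable_argmin (X := X) (φ := fun ω x => y ω (v ω - x) + bregman X ψ x (v ω))
    (fun x hx => ?_) (fun ω => ?_) (fun ω => (hq ω).1) fun ω x hx => ?_
  · exact (stronglyMeasurable_dual_apply hy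
      (hv.sub measurable_const).stronglyMeasurable).measurable.add
      (h.measurable_bregman_right hv hvX hx)
  · exact ((y ω).continuous.comp (continuous_const.sub continuous_id)).continuousOn.add
      (h.continuousOn_bregman _)
  · have hf : StrongConvexOn X 1 (fun x => y ω (v ω - x) + bregman X ψ x (v ω)) := by
      convert (h.strongConvexOn_bregman (v ω)).add_clm_const (-(y ω)) (y ω (v ω)) using 2 with x
      simp only [map_sub, neg_apply]
      ring
    exact hf.add_sq_le_of_isMinOn (hq ω).1 hx (hq ω).2

end Measurability

section LinearDynamics

variable {E : Type*} [NormedAddCommGroup E] [NormedSpace ℝ E] {n : ℕ}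

/-- The mean of a finite family of vectors. -/
def mean (x : Fin n → E) : E := (n : ℝ)⁻¹ • ∑ i, x i

lemma mix_mem {k : ℕ} {X : Set E} (hX : Convex ℝ X) {w : Matrix (Fin k) (Fin n) ℝ}
    {x : Fin n → E} {i : Fin k} (hw : ∀ j, 0 ≤ w i j) (hsum : ∑ j, w i j = 1)
    (hx : ∀ j, x j ∈ X) : mix w x i ∈ X :=
  hX.sum_mem (fun j _ => hw j) hsum fun j _ => hx j

lemma mean_mem {X : Set E} (hX : Convex ℝ X) (hn : 0 < n) {x : Fin n → E} (hx : ∀ j, x j ∈ X) :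
    mean x ∈ X := by
  have hn' : (n : ℝ) ≠ 0 := by positivity
  unfold mean
  rw [Finset.smul_sum]
  exact hX.sum_mem (fun j _ => by positivity) (by simp [hn']) fun j _ => hx j

lemma norm_mix_sub_le {k : ℕ} {w : Matrix (Fin k) (Fin n) ℝ} {x : Fin n → E} {i : Fin k}
    (hw : ∀ j, 0 ≤ w i j) (hsum : ∑ j, w i j = 1) (c : E) :
    ‖mix w x i - c‖ ≤ ∑ j, w i j * ‖x j - c‖ := by
  have : mix w x i - c = ∑ j, w i j • (x j - c) := by
    simp only [mix, smul_sub, Finset.sum_sub_distrib, ← Finset.sum_smul, hsum, one_smul]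
  rw [this]
  refine (norm_sum_le _ _).trans (Finset.sum_le_sum fun j _ => ?_)
  rw [norm_smul, Real.norm_of_nonneg (hw j)]

lemma mix_add (w : Matrix (Fin n) (Fin n) ℝ) (x y : Fin n → E) (i : Fin n) :
    mix w (fun j => x j + y j) i = mix w x i + mix w y i := by
  simp only [mix, smul_add, Finset.sum_add_distrib]

lemma mix_mix (v w : Matrix (Fin n) (Fin n) ℝ) (x : Fin n → E) (i : Fin n) :
    mix v (fun j => mix w x j) i = mix (v * w) x i := by
  simp only [mix, Matrix.mul_apply, Finset.sum_smul, Finset.smul_sum, smul_smul]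
  rw [Finset.sum_comm]

lemma mix_sum {ι : Type*} (s : Finset ι) (w : Matrix (Fin n) (Fin n) ℝ) (x : ι → Fin n → E)
    (i : Fin n) : mix w (fun j => ∑ a ∈ s, x a j) i = ∑ a ∈ s, mix w (x a) i := by
  simp only [mix, Finset.smul_sum]
  rw [Finset.sum_comm]

lemma mean_mix {w : Matrix (Fin n) (Fin n) ℝ} (hcol : ∀ j, ∑ i, w i j = 1) (x : Fin n → E) :
    mean (mix w x) = mean x := by
  unfold mean mix
  rw [Finset.sum_comm]
  simp only [← Finset.sum_smul, hcol, one_smul]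

lemma mean_add (x y : Fin n → E) : mean (fun i => x i + y i) = mean x + mean y := by
  simp only [mean, Finset.sum_add_distrib, smul_add]

variable {W : ℕ → Matrix (Fin n) (Fin n) ℝ} {x r : ℕ → Fin n → E}

lemma state_eq_transition (hx : ∀ t i, x (t + 1) i = mix (W t) (x t) i + r t i) (t : ℕ)
    (i : Fin n) :
    x t i = mix (transition W 0 t) (x 0) i +
      ∑ s ∈ Finset.range t, mix (transition W (s + 1) (t - 1 - s)) (r s) i := by
  induction t generalizing i with
  | zero => simp [mix, transition, Matrix.one_apply]
  | succ t ih =>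
    have e : x t = fun i => mix (transition W 0 t) (x 0) i +
      ∑ s ∈ Finset.range t, mix (transition W (s + 1) (t - 1 - s)) (r s) i := funext ih
    rw [hx, e, mix_add, mix_sum, mix_mix, Finset.sum_range_succ, ← add_assoc]
    congr 1
    · congr 1
      · simp [transition]
      · refine Finset.sum_congr rfl fun s hs => ?_
        rw [Finset.mem_range] at hs
        rw [mix_mix, show t + 1 - 1 - s = (t - 1 - s) + 1 by omega, transition,
          show s + 1 + (t - 1 - s) = t by omega]
    · simp [mix, transition, Matrix.one_apply]

lemma mean_state_eq (hcol : ∀ t j, ∑ i, W t i j = 1)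
    (hx : ∀ t i, x (t + 1) i = mix (W t) (x t) i + r t i) (t : ℕ) :
    mean (x t) = mean (x 0) + ∑ s ∈ Finset.range t, mean (r s) := by
  induction t with
  | zero => simp
  | succ t ih =>
    rw [Finset.sum_range_succ, ← add_assoc, ← ih, ← mean_mix (hcol t) (x t), ← mean_add]
    congr 1
    exact funext (hx t)

lemma norm_mix_sub_mean_le {w : Matrix (Fin n) (Fin n) ℝ} {x : Fin n → E} {i : Fin n} {c : ℝ}
    (hw : ∀ j, |w i j - 1 / n| ≤ c) : ‖mix w x i - mean x‖ ≤ c * ∑ j, ‖x j‖ := by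
  have : mix w x i - mean x = ∑ j, (w i j - 1 / n) • x j := by
    simp only [mix, mean, sub_smul, Finset.sum_sub_distrib, one_div, Finset.smul_sum]
  rw [this, Finset.mul_sum]
  refine (norm_sum_le _ _).trans (Finset.sum_le_sum fun j _ => ?_)
  rw [norm_smul, Real.norm_eq_abs]
  exact mul_le_mul_of_nonneg_right (hw j) (norm_nonneg _)

/-- The distance of the states of perturbed averaging dynamics from their mean. -/
theorem IsMixing.norm_state_sub_mean_le {η : ℝ} {B : ℕ} {G : ℕ → Digraph (Fin n)}
    (h : IsMixing η B G W) (hη : 0 < η) (hη1 : η < 1)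
    (hx : ∀ t i, x (t + 1) i = mix (W t) (x t) i + r t i) (t : ℕ) (i : Fin n) :
    ‖x t i - mean (x t)‖ ≤ Gam η n * theta η n B ^ t * ∑ j, ‖x 0 j‖ +
      ∑ s ∈ Finset.range t, Gam η n * theta η n B ^ (t - 1 - s) * ∑ j, ‖r s j‖ := by
  rw [state_eq_transition hx, mean_state_eq h.col_sum hx, add_sub_add_comm,
    ← Finset.sum_sub_distrib]
  refine (norm_add_le _ _).trans (add_le_add ?_ ?_)
  · exact norm_mix_sub_mean_le (h.abs_transition_sub_le hη hη1 0 t i)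
  · exact (norm_sum_le _ _).trans (Finset.sum_le_sum fun s _ =>
      norm_mix_sub_mean_le (h.abs_transition_sub_le hη hη1 (s + 1) (t - 1 - s) i))

lemma sum_mul_geometric_le {α : ℕ → ℝ} (hα : Antitone α) (hα0 : ∀ t, 0 ≤ α t) {θ : ℝ}
    (hθ0 : 0 ≤ θ) (hθ1 : θ < 1) (T : ℕ) :
    ∑ t ∈ Finset.range T, α t * θ ^ t ≤ α 0 / (1 - θ) := by
  calc ∑ t ∈ Finset.range T, α t * θ ^ t ≤ ∑ t ∈ Finset.range T, α 0 * θ ^ t :=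
        Finset.sum_le_sum fun t _ =>
          mul_le_mul_of_nonneg_right (hα (Nat.zero_le t)) (pow_nonneg hθ0 t)
    _ = α 0 * ∑ t ∈ Finset.range T, θ ^ t := (Finset.mul_sum _ _ _).symm
    _ ≤ α 0 * (1 - θ)⁻¹ := by
        refine mul_le_mul_of_nonneg_left ?_ (hα0 0)
        rw [← tsum_geometric_of_lt_one hθ0 hθ1]
        exact (summable_geometric_of_lt_one hθ0 hθ1).sum_le_tsum _ fun t _ => pow_nonneg hθ0 t
    _ = α 0 / (1 - θ) := (div_eq_mul_inv _ _).symm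

lemma sum_mul_convolution_le {α : ℕ → ℝ} (hα : Antitone α) (hα0 : ∀ t, 0 ≤ α t) {θ : ℝ}
    (hθ0 : 0 ≤ θ) (hθ1 : θ < 1) (T : ℕ) :
    ∑ t ∈ Finset.range T, α t * ∑ s ∈ Finset.range t, θ ^ (t - 1 - s) * α s ≤
      (∑ t ∈ Finset.range T, α t ^ 2) / (1 - θ) := by
  set q : ℕ → ℝ := fun t => ∑ s ∈ Finset.range t, θ ^ (t - 1 - s) * α s ^ 2 with hq
  have hq0 : ∀ t, 0 ≤ q t := fun t =>
    Finset.sum_nonneg fun s _ => mul_nonneg (pow_nonneg hθ0 _) (sq_nonneg _)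
  have hrec : ∀ t, q (t + 1) = θ * q t + α t ^ 2 := by
    intro t
    simp only [hq]
    rw [Finset.sum_range_succ, Finset.mul_sum]
    congr 1
    · refine Finset.sum_congr rfl fun s hs => ?_
      rw [Finset.mem_range] at hs
      rw [show t + 1 - 1 - s = (t - 1 - s) + 1 by omega, pow_succ]
      ring
    · simp
  have hsum : ∀ T, (1 - θ) * ∑ t ∈ Finset.range T, q t + q T = ∑ t ∈ Finset.range T, α t ^ 2 := by
    intro T
    induction T with
    | zero => simp [hq]
    | succ T ih => rw [Finset.sum_range_succ, Finset.sum_range_succ, ← ih, hrec]; ring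
  have h1 : ∑ t ∈ Finset.range T, α t * ∑ s ∈ Finset.range t, θ ^ (t - 1 - s) * α s ≤
      ∑ t ∈ Finset.range T, q t := by
    refine Finset.sum_le_sum fun t _ => ?_
    rw [Finset.mul_sum]
    refine Finset.sum_le_sum fun s hs => ?_
    have hts : α t ≤ α s := hα (Finset.mem_range.1 hs).le
    have := mul_le_mul_of_nonneg_left (mul_le_mul_of_nonneg_right hts (hα0 s))
      (pow_nonneg hθ0 (t - 1 - s))
    linarith
  refine h1.trans ?_
  rw [le_div_iff₀ (by linarith)]
  linarith [hsum T, hq0 T]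

end LinearDynamics

section Noise

variable {Ω E : Type*} {ℱ : MeasurableSpace Ω} [mΩ : MeasurableSpace Ω] [NormedAddCommGroup E]
  [NormedSpace ℝ E] {P : Measure Ω}

/-- The conditionally centered part of a random functional. -/
def noise (P : Measure Ω) (ℱ : MeasurableSpace Ω) (ghat : Ω → StrongDual ℝ E) :
    Ω → StrongDual ℝ E := fun ω => ghat ω - (P[ghat | ℱ]) ω

variable {X : Set E} {h : Ω → E → ℝ} {v : Ω → E} {ghat : Ω → StrongDual ℝ E} {L ν : ℝ}

namespace UnbiasedBounded

lemma ae_subgradient (hb : UnbiasedBounded P ℱ X h v ghat L ν) :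
    ∀ᵐ ω ∂P, IsSubgradientOn X (h ω) (v ω) (ghat ω - noise P ℱ ghat ω) := by
  obtain ⟨g, hg, -, hge, -⟩ := hb
  filter_upwards [hg, hge] with ω h1 h2
  simpa [noise, h2] using h1.1

lemma integrable (hb : UnbiasedBounded P ℱ X h v ghat L ν) : Integrable ghat P := by
  obtain ⟨g, -, hi, -⟩ := hb
  exact hi

lemma integrable_noise (hb : UnbiasedBounded P ℱ X h v ghat L ν) :
    Integrable (noise P ℱ ghat) P := hb.integrable.sub integrable_condExp

lemma integrable_noise_sq (hb : UnbiasedBounded P ℱ X h v ghat L ν) :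
    Integrable (fun ω => ‖noise P ℱ ghat ω‖ ^ 2) P := by
  obtain ⟨g, -, -, hge, hi, -⟩ := hb
  refine hi.congr ?_
  filter_upwards [hge] with ω h2
  rw [noise, h2, norm_sub_rev]

lemma integral_noise_sq_le [IsProbabilityMeasure P]
    (hb : UnbiasedBounded P ℱ X h v ghat L ν) (hℱ : ℱ ≤ mΩ) :
    ∫ ω, ‖noise P ℱ ghat ω‖ ^ 2 ∂P ≤ ν ^ 2 := by
  obtain ⟨g, -, -, hge, -, hle⟩ := hb
  have e : ∫ ω, ‖noise P ℱ ghat ω‖ ^ 2 ∂P = ∫ ω, ‖g ω - ghat ω‖ ^ 2 ∂P := by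
    refine integral_congr_ae ?_
    filter_upwards [hge] with ω h2
    simp only [noise, h2, norm_sub_rev]
  rw [e, ← integral_condExp hℱ]
  calc _ ≤ ∫ _ω, ν ^ 2 ∂P := integral_mono_ae integrable_condExp (integrable_const _) hle
    _ = ν ^ 2 := by simp

lemma ae_norm_le (hb : UnbiasedBounded P ℱ X h v ghat L ν) :
    ∀ᵐ ω ∂P, ‖ghat ω‖ ≤ L + ‖noise P ℱ ghat ω‖ := by
  obtain ⟨g, hg, -, hge, -⟩ := hb
  filter_upwards [hg, hge] with ω h1 h2
  have e : ghat ω = g ω + noise P ℱ ghat ω := by rw [noise, h2]; abel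
  calc ‖ghat ω‖ = ‖g ω + noise P ℱ ghat ω‖ := by rw [← e]
    _ ≤ ‖g ω‖ + ‖noise P ℱ ghat ω‖ := norm_add_le _ _
    _ ≤ _ := by linarith [h1.2]

lemma integral_norm_noise_le [IsProbabilityMeasure P]
    (hb : UnbiasedBounded P ℱ X h v ghat L ν) (hℱ : ℱ ≤ mΩ)
    (hν : 0 < ν) : ∫ ω, ‖noise P ℱ ghat ω‖ ∂P ≤ ν := by
  calc ∫ ω, ‖noise P ℱ ghat ω‖ ∂P
      ≤ ∫ ω, ((2 * ν)⁻¹ * ‖noise P ℱ ghat ω‖ ^ 2 + ν / 2) ∂P := by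
        refine integral_mono hb.integrable_noise.norm
          ((hb.integrable_noise_sq.const_mul _).add (integrable_const _)) fun ω => ?_
        simp only
        have : (2 * ν)⁻¹ * ‖noise P ℱ ghat ω‖ ^ 2 + ν / 2 - ‖noise P ℱ ghat ω‖ =
            (2 * ν)⁻¹ * (‖noise P ℱ ghat ω‖ - ν) ^ 2 := by
          field_simp; ring
        have h0 : 0 ≤ (2 * ν)⁻¹ * (‖noise P ℱ ghat ω‖ - ν) ^ 2 := by positivity
        linarith
    _ = (2 * ν)⁻¹ * ∫ ω, ‖noise P ℱ ghat ω‖ ^ 2 ∂P + ν / 2 := by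
        rw [integral_add (hb.integrable_noise_sq.const_mul _) (integrable_const _),
          integral_const_mul]
        simp
    _ ≤ (2 * ν)⁻¹ * ν ^ 2 + ν / 2 := by
        have := hb.integral_noise_sq_le hℱ
        gcongr
    _ = ν := by field_simp; ring

lemma integral_norm_le [IsProbabilityMeasure P]
    (hb : UnbiasedBounded P ℱ X h v ghat L ν) (hℱ : ℱ ≤ mΩ)
    (hν : 0 < ν) : ∫ ω, ‖ghat ω‖ ∂P ≤ L + ν := by
  calc ∫ ω, ‖ghat ω‖ ∂P ≤ ∫ ω, (L + ‖noise P ℱ ghat ω‖) ∂P :=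
        integral_mono_ae hb.integrable.norm
          ((integrable_const _).add hb.integrable_noise.norm) hb.ae_norm_le
    _ = L + ∫ ω, ‖noise P ℱ ghat ω‖ ∂P := by
        rw [integral_add (integrable_const _) hb.integrable_noise.norm]; simp
    _ ≤ L + ν := by linarith [hb.integral_norm_noise_le hℱ hν]

lemma integrable_bound_sq [IsProbabilityMeasure P] (hb : UnbiasedBounded P ℱ X h v ghat L ν) :
    Integrable (fun ω => (L + ‖noise P ℱ ghat ω‖) ^ 2) P := by
  have : (fun ω => (L + ‖noise P ℱ ghat ω‖) ^ 2) =
      fun ω => L ^ 2 + 2 * L * ‖noise P ℱ ghat ω‖ + ‖noise P ℱ ghat ω‖ ^ 2 := by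
    ext ω; ring
  rw [this]
  exact ((integrable_const _).add (hb.integrable_noise.norm.const_mul _)).add
    hb.integrable_noise_sq

lemma ae_norm_sq_le (hb : UnbiasedBounded P ℱ X h v ghat L ν) :
    ∀ᵐ ω ∂P, ‖ghat ω‖ ^ 2 ≤ (L + ‖noise P ℱ ghat ω‖) ^ 2 := by
  filter_upwards [hb.ae_norm_le] with ω hω
  exact pow_le_pow_left₀ (norm_nonneg _) hω 2

lemma integrable_norm_sq [IsProbabilityMeasure P] (hb : UnbiasedBounded P ℱ X h v ghat L ν) :
    Integrable (fun ω => ‖ghat ω‖ ^ 2) P := by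
  refine hb.integrable_bound_sq.mono' (hb.integrable.aestronglyMeasurable.norm.pow 2) ?_
  filter_upwards [hb.ae_norm_sq_le] with ω hω
  rwa [Real.norm_of_nonneg (sq_nonneg _)]

lemma integral_norm_sq_le [IsProbabilityMeasure P]
    (hb : UnbiasedBounded P ℱ X h v ghat L ν) (hℱ : ℱ ≤ mΩ)
    (hL : 0 ≤ L) (hν : 0 < ν) : ∫ ω, ‖ghat ω‖ ^ 2 ∂P ≤ (L + ν) ^ 2 := by
  calc ∫ ω, ‖ghat ω‖ ^ 2 ∂P ≤ ∫ ω, (L + ‖noise P ℱ ghat ω‖) ^ 2 ∂P :=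
        integral_mono_ae hb.integrable_norm_sq hb.integrable_bound_sq hb.ae_norm_sq_le
    _ = ∫ ω, (L ^ 2 + 2 * L * ‖noise P ℱ ghat ω‖ + ‖noise P ℱ ghat ω‖ ^ 2) ∂P := by
        congr 1; ext ω; ring
    _ = L ^ 2 + 2 * L * ∫ ω, ‖noise P ℱ ghat ω‖ ∂P + ∫ ω, ‖noise P ℱ ghat ω‖ ^ 2 ∂P := by
        have hi : Integrable (fun ω => L ^ 2 + 2 * L * ‖noise P ℱ ghat ω‖) P :=
          (integrable_const _).add (hb.integrable_noise.norm.const_mul _)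
        rw [integral_add hi hb.integrable_noise_sq, integral_add (integrable_const _)
          (hb.integrable_noise.norm.const_mul _), integral_const_mul]
        simp
    _ ≤ L ^ 2 + 2 * L * ν + ν ^ 2 := by
        have h1 := hb.integral_norm_noise_le hℱ hν
        have h2 := hb.integral_noise_sq_le hℱ
        gcongr
    _ = (L + ν) ^ 2 := by ring

end UnbiasedBounded

lemma integrable_apply_of_bounded {e : Ω → StrongDual ℝ E} (he : Integrable e P) {u : Ω → E}
    (hu : AEStronglyMeasurable u P) {C : ℝ} (hC : ∀ ω, ‖u ω‖ ≤ C) :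
    Integrable (fun ω => e ω (u ω)) P :=
  (ContinuousLinearMap.apply ℝ ℝ : E →L[ℝ] (E →L[ℝ] ℝ) →L[ℝ] ℝ).integrable_of_bilin_of_bdd_left C
    hu (ae_of_all _ hC) he

lemma integral_noise_apply_eq_zero [IsProbabilityMeasure P] [CompleteSpace E] (hℱ : ℱ ≤ mΩ) (hg : Integrable ghat P)
    {u : Ω → E} (hu : StronglyMeasurable[ℱ] u) {C : ℝ} (hC : ∀ ω, ‖u ω‖ ≤ C) :
    ∫ ω, noise P ℱ ghat ω (u ω) ∂P = 0 := by
  have hn : Integrable (noise P ℱ ghat) P := hg.sub integrable_condExp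
  have hi := integrable_apply_of_bounded hn (hu.mono hℱ).aestronglyMeasurable hC
  have hpull := condExp_bilin_of_stronglyMeasurable_left (μ := P)
    (ContinuousLinearMap.apply ℝ ℝ : E →L[ℝ] (E →L[ℝ] ℝ) →L[ℝ] ℝ) hu hi hn
  have hzero : P[noise P ℱ ghat | ℱ] =ᵐ[P] 0 := by
    have h1 : P[noise P ℱ ghat | ℱ] =ᵐ[P] P[ghat | ℱ] - P[P[ghat | ℱ] | ℱ] :=
      condExp_sub hg integrable_condExp ℱ
    rw [condExp_of_stronglyMeasurable hℱ stronglyMeasurable_condExp integrable_condExp,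
      sub_self] at h1
    exact h1
  rw [← integral_condExp hℱ]
  refine integral_eq_zero_of_ae ?_
  filter_upwards [hpull, hzero] with ω h1 h2
  rw [show (P[fun ω => noise P ℱ ghat ω (u ω) | ℱ]) ω = _ from h1, h2]
  simp

end Noise

section OneNetwork

variable {Ω E : Type*} [mΩ : MeasurableSpace Ω] [NormedAddCommGroup E] [NormedSpace ℝ E]
  [MeasurableSpace E] {n : ℕ}

/-- Distributed stochastic mirror descent within one network of `n` agents: at time `t` agent `i`
receives an unbiased estimate `g t i` of a subgradient of its current objective `h t i`. -/
structure IsMirrorDescent (P : Measure Ω) (ℱ : ℕ → MeasurableSpace Ω) (X : Set E) (ψ : E → ℝ)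
    (α : ℕ → ℝ) (η : ℝ) (B : ℕ) (G : ℕ → Digraph (Fin n)) (W : ℕ → Matrix (Fin n) (Fin n) ℝ)
    (L ν : ℝ) (h : ℕ → Fin n → Ω → E → ℝ) (x : ℕ → Fin n → Ω → E)
    (g : ℕ → Fin n → Ω → StrongDual ℝ E) : Prop where
  isCompact : IsCompact X
  isRegularizer : IsRegularizer X ψ
  convexOn_right : ∀ x ∈ X, ConvexOn ℝ X (fun y => bregman X ψ x y)
  monotone : Monotone ℱ
  le : ∀ t, ℱ t ≤ mΩ
  isMixing : IsMixing η B G W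
  η_pos : 0 < η
  η_lt_one : η < 1
  antitone : Antitone α
  nonneg : ∀ t, 0 ≤ α t
  L_nonneg : 0 ≤ L
  ν_pos : 0 < ν
  measurable_init : ∀ i, Measurable[ℱ 0] (x 0 i)
  init_mem : ∀ i ω, x 0 i ω ∈ X
  measurable_subgradient : ∀ t i, StronglyMeasurable[ℱ (t + 1)] (g t i)
  step : ∀ t i ω, IsProx X ψ (mix (W t) (fun k => x t k ω) i) (-(α t • g t i ω)) (x (t + 1) i ω)
  sampling : ∀ t i, UnbiasedBounded P (ℱ t) X (h t i)
    (fun ω => mix (W t) (fun k => x t k ω) i) (g t i) L ν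

namespace IsMirrorDescent

variable {P : Measure Ω} {ℱ : ℕ → MeasurableSpace Ω} {X : Set E} {ψ : E → ℝ}
    {α : ℕ → ℝ} {η : ℝ} {B : ℕ} {G : ℕ → Digraph (Fin n)} {W : ℕ → Matrix (Fin n) (Fin n) ℝ}
    {L ν : ℝ} {h : ℕ → Fin n → Ω → E → ℝ} {x : ℕ → Fin n → Ω → E}
    {g : ℕ → Fin n → Ω → StrongDual ℝ E}

lemma mem (H : IsMirrorDescent P ℱ X ψ α η B G W L ν h x g) (t : ℕ) (i : Fin n) (ω : Ω) :
    x t i ω ∈ X := by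
  cases t with
  | zero => exact H.init_mem i ω
  | succ t => exact (H.step t i ω).1

lemma convex (H : IsMirrorDescent P ℱ X ψ α η B G W L ν h x g) : Convex ℝ X :=
  H.isRegularizer.strongConvexOn.1

lemma mix_mem (H : IsMirrorDescent P ℱ X ψ α η B G W L ν h x g) (t : ℕ) (i : Fin n) (ω : Ω) :
    mix (W t) (fun k => x t k ω) i ∈ X :=
  DSMD.mix_mem H.convex (H.isMixing.weight_nonneg H.η_pos t i) (H.isMixing.row_sum t i)
    fun k => H.mem t k ω

lemma exists_norm_le (H : IsMirrorDescent P ℱ X ψ α η B G W L ν h x g) :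
    ∃ C, ∀ z ∈ X, ‖z‖ ≤ C := H.isCompact.isBounded.exists_norm_le

lemma sum_bregman_mix_le (H : IsMirrorDescent P ℱ X ψ α η B G W L ν h x g) {z : E} (hz : z ∈ X)
    (t : ℕ) (ω : Ω) :
    ∑ k, bregman X ψ z (mix (W t) (fun a => x t a ω) k) ≤ ∑ k, bregman X ψ z (x t k ω) := by
  calc ∑ k, bregman X ψ z (mix (W t) (fun a => x t a ω) k)
      ≤ ∑ k, ∑ a, W t k a * bregman X ψ z (x t a ω) :=
        Finset.sum_le_sum fun k _ => (H.convexOn_right z hz).map_sum_le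
          (fun a _ => H.isMixing.weight_nonneg H.η_pos t k a) (H.isMixing.row_sum t k)
          fun a _ => H.mem t a ω
    _ = _ := by
        rw [Finset.sum_comm]
        simp only [← Finset.sum_mul, H.isMixing.col_sum, one_mul]

lemma integral_norm_init_le [BorelSpace E] [IsProbabilityMeasure P]
    (H : IsMirrorDescent P ℱ X ψ α η B G W L ν h x g) (i : Fin n) :
    Integrable (fun ω => ‖x 0 i ω‖) P ∧
      ∫ ω, ‖x 0 i ω‖ ∂P ≤ ∫ ω, (⨆ k, ‖x 0 k ω‖) ∂P := by
  obtain ⟨C, hC⟩ := H.exists_norm_le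
  have hm : ∀ k, Measurable fun ω => ‖x 0 k ω‖ := fun k =>
    ((H.measurable_init k).mono (H.le 0) le_rfl).norm
  have hbdd : ∀ ω, BddAbove (Set.range fun k => ‖x 0 k ω‖) := fun ω => Set.finite_range _ |>.bddAbove
  have h1 : Integrable (fun ω => ‖x 0 i ω‖) P :=
    Integrable.of_bound (hm i).aestronglyMeasurable C
      (ae_of_all _ fun ω => by rw [norm_norm]; exact hC _ (H.mem 0 i ω))
  have : Nonempty (Fin n) := ⟨i⟩
  have h2 : Integrable (fun ω => ⨆ k, ‖x 0 k ω‖) P :=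
    Integrable.of_bound (Measurable.iSup hm).aestronglyMeasurable C
      (ae_of_all _ fun ω => by
        rw [Real.norm_of_nonneg (Real.iSup_nonneg fun k => norm_nonneg _)]
        exact ciSup_le fun k => hC _ (H.mem 0 k ω))
  exact ⟨h1, integral_mono h1 h2 fun ω => le_ciSup (hbdd ω) i⟩

variable [FiniteDimensional ℝ E] [BorelSpace E]

lemma measurable_state (H : IsMirrorDescent P ℱ X ψ α η B G W L ν h x g) (t : ℕ) (i : Fin n) :
    Measurable[ℱ t] (x t i) := by
  have : ProperSpace E := FiniteDimensional.proper ℝ E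
  induction t generalizing i with
  | zero => exact H.measurable_init i
  | succ t ih =>
    have hv : Measurable[ℱ t] fun ω => mix (W t) (fun k => x t k ω) i :=
      Finset.measurable_fun_sum _ fun k _ => (ih k).const_smul _
    exact H.isRegularizer.measurable_prox (m := ℱ (t + 1))
      (hv.mono (H.monotone (Nat.le_succ t)) le_rfl) (H.mix_mem t i)
      ((H.measurable_subgradient t i).const_smul (α t)).neg (H.step t i)

lemma measurable_mix (H : IsMirrorDescent P ℱ X ψ α η B G W L ν h x g) (t : ℕ) (i : Fin n) :
    Measurable[ℱ t] fun ω => mix (W t) (fun k => x t k ω) i := by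
  have : ProperSpace E := FiniteDimensional.proper ℝ E
  exact Finset.measurable_fun_sum _ fun k _ => (H.measurable_state t k).const_smul _

lemma exists_ghost (H : IsMirrorDescent P ℱ X ψ α η B G W L ν h x g) (i : Fin n) :
    ∃ w : ℕ → Ω → E, (∀ t, StronglyMeasurable[ℱ t] (w t)) ∧ (∀ t ω, w t ω ∈ X) ∧
      ∀ T ω, ∀ z ∈ X, ∑ t ∈ Finset.range T, α t * noise P (ℱ t) (g t i) ω (z - w t ω) ≤
        bregmanDiamSq X ψ +
          ∑ t ∈ Finset.range T, 1 / 2 * (α t ^ 2 * ‖noise P (ℱ t) (g t i) ω‖ ^ 2) := by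
  have : ProperSpace E := FiniteDimensional.proper ℝ E
  rcases isEmpty_or_nonempty Ω with hΩ | ⟨⟨ω₀⟩⟩
  · exact ⟨fun t => x t i, fun t => (H.measurable_state t i).stronglyMeasurable, fun t ω => (hΩ.false ω).elim,
      fun T ω => (hΩ.false ω).elim⟩
  have hx₀ := H.mem 0 i ω₀
  obtain ⟨π, hπ, hπc, hmax⟩ := H.isRegularizer.exists_mirrorMap H.isCompact hx₀
  refine ⟨fun t ω => π (∑ s ∈ Finset.range t, α s • noise P (ℱ s) (g s i) ω), fun t => ?_,
    fun t ω => hπ _, fun T ω z hz => ?_⟩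
  · refine hπc.comp_stronglyMeasurable (Finset.stronglyMeasurable_fun_sum _ fun s hs => ?_)
    have hst : s + 1 ≤ t := Finset.mem_range.1 hs
    refine StronglyMeasurable.fun_const_smul (f := noise P (ℱ s) (g s i))
      (StronglyMeasurable.sub ?_ ?_) _
    · exact (H.measurable_subgradient s i).mono (H.monotone hst)
    · exact stronglyMeasurable_condExp.mono (H.monotone ((Nat.le_succ s).trans hst))
  · have := IsRegularizer.dual_averaging_regret hπ
      (fun z hz => H.isRegularizer.bregman_nonneg hz hx₀) hmax
      (fun s => α s • noise P (ℱ s) (g s i) ω) T hz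
    simp only [smul_apply, smul_eq_mul, norm_smul, mul_pow, Real.norm_eq_abs, sq_abs] at this
    exact this.trans (add_le_add_left (H.isRegularizer.bregman_le hz hx₀) _)

variable [IsProbabilityMeasure P]

/-- The mean regret of the agents is dominated, uniformly over the comparison points, by an
integrable random variable with a small expectation. -/
theorem exists_regret_bound (H : IsMirrorDescent P ℱ X ψ α η B G W L ν h x g) (hn : 0 < n)
    (T : ℕ) :
    ∃ Ψ : Ω → ℝ, Integrable Ψ P ∧
      (∀ᵐ ω ∂P, ∀ z ∈ X, ∑ t ∈ Finset.range T, α t * ((1 / (n : ℝ)) *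
        ∑ k, (h t k ω (mix (W t) (fun a => x t a ω) k) - h t k ω z)) ≤ Ψ ω) ∧
      ∫ ω, Ψ ω ∂P ≤ 2 * bregmanDiamSq X ψ +
        (1 / 2 * (L + ν) ^ 2 + 1 / 2 * ν ^ 2) * ∑ t ∈ Finset.range T, α t ^ 2 := by
  have : ProperSpace E := FiniteDimensional.proper ℝ E
  have hn' : (0 : ℝ) < n := by exact_mod_cast hn
  choose w hwm hwX hw using fun i => H.exists_ghost i
  obtain ⟨C, hC⟩ := H.exists_norm_le
  set v : ℕ → Fin n → Ω → E := fun t k ω => mix (W t) (fun a => x t a ω) k with hv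
  set e : ℕ → Fin n → Ω → StrongDual ℝ E := fun t k => noise P (ℱ t) (g t k) with he
  set R := bregmanDiamSq X ψ
  set c : ℕ → Fin n → Ω → ℝ := fun t k ω => 1 / 2 * (α t ^ 2 * ‖g t k ω‖ ^ 2) +
    1 / 2 * (α t ^ 2 * ‖e t k ω‖ ^ 2) - α t * e t k ω (v t k ω - w k t ω) with hc
  have hvw : ∀ t k ω, ‖v t k ω - w k t ω‖ ≤ C + C := fun t k ω =>
    (norm_sub_le _ _).trans (add_le_add (hC _ (H.mix_mem t k ω)) (hC _ (hwX k t ω)))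
  have hvwm : ∀ t k, StronglyMeasurable[ℱ t] fun ω => v t k ω - w k t ω := fun t k =>
    (H.measurable_mix t k).stronglyMeasurable.sub (hwm k t)
  have i1 : ∀ t k, Integrable (fun ω => 1 / 2 * (α t ^ 2 * ‖g t k ω‖ ^ 2)) P := fun t k =>
    ((H.sampling t k).integrable_norm_sq.const_mul _).const_mul _
  have i2 : ∀ t k, Integrable (fun ω => 1 / 2 * (α t ^ 2 * ‖e t k ω‖ ^ 2)) P := fun t k =>
    ((H.sampling t k).integrable_noise_sq.const_mul _).const_mul _
  have i3 : ∀ t k, Integrable (fun ω => α t * e t k ω (v t k ω - w k t ω)) P := fun t k =>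
    (integrable_apply_of_bounded (H.sampling t k).integrable_noise
      ((hvwm t k).mono (H.le t)).aestronglyMeasurable (hvw t k)).const_mul _
  have i12 : ∀ t k, Integrable (fun ω => 1 / 2 * (α t ^ 2 * ‖g t k ω‖ ^ 2) +
    1 / 2 * (α t ^ 2 * ‖e t k ω‖ ^ 2)) P := fun t k => (i1 t k).add (i2 t k)
  have ic : ∀ t k, Integrable (c t k) P := fun t k => (i12 t k).sub (i3 t k)
  have hcint : ∀ t k, ∫ ω, c t k ω ∂P ≤ (1 / 2 * (L + ν) ^ 2 + 1 / 2 * ν ^ 2) * α t ^ 2 := by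
    intro t k
    have hz : ∫ ω, e t k ω (v t k ω - w k t ω) ∂P = 0 :=
      integral_noise_apply_eq_zero (H.le t) (H.sampling t k).integrable (hvwm t k) (hvw t k)
    simp only [hc]
    rw [integral_sub (i12 t k) (i3 t k), integral_add (i1 t k) (i2 t k)]
    simp only [integral_const_mul]
    rw [hz]
    have b1 := mul_le_mul_of_nonneg_left
      ((H.sampling t k).integral_norm_sq_le (H.le t) H.L_nonneg H.ν_pos) (sq_nonneg (α t))
    have b2 := mul_le_mul_of_nonneg_left
      ((H.sampling t k).integral_noise_sq_le (H.le t)) (sq_nonneg (α t))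
    linarith
  have is : Integrable (fun ω => (1 / (n : ℝ)) * ∑ k, ∑ t ∈ Finset.range T, c t k ω) P :=
    (integrable_finsetSum _ fun k _ => integrable_finsetSum _ fun t _ => ic t k).const_mul _
  refine ⟨fun ω => 2 * R + (1 / (n : ℝ)) * ∑ k, ∑ t ∈ Finset.range T, c t k ω,
    (integrable_const _).add is, ?_, ?_⟩
  · have hsub : ∀ᵐ ω ∂P, ∀ t k, IsSubgradientOn X (h t k ω) (v t k ω) (g t k ω - e t k ω) :=
      ae_all_iff.2 fun t => ae_all_iff.2 fun k => (H.sampling t k).ae_subgradient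
    filter_upwards [hsub] with ω hω z hz
    have hstep : ∀ t k, α t * (h t k ω (v t k ω) - h t k ω z) ≤
        (bregman X ψ z (v t k ω) - bregman X ψ z (x (t + 1) k ω)) + c t k ω +
          (α t * e t k ω (z - w k t ω) - 1 / 2 * (α t ^ 2 * ‖e t k ω‖ ^ 2)) := by
      intro t k
      have h1 := hω t k z hz
      have h2 := H.isRegularizer.mirror_step (H.mix_mem t k ω) (H.step t k ω) hz
      have h3 := mul_le_mul_of_nonneg_left h1 (H.nonneg t)
      simp only [sub_apply, map_sub, mul_pow] at h2 h3
      simp only [hc, map_sub]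
      simp only [hv] at h3 ⊢
      linarith
    have hbreg : ∑ t ∈ Finset.range T, ∑ k,
        (bregman X ψ z (v t k ω) - bregman X ψ z (x (t + 1) k ω)) ≤ n * R := by
      calc ∑ t ∈ Finset.range T, ∑ k,
            (bregman X ψ z (v t k ω) - bregman X ψ z (x (t + 1) k ω))
          ≤ ∑ t ∈ Finset.range T, (∑ k, bregman X ψ z (x t k ω) -
              ∑ k, bregman X ψ z (x (t + 1) k ω)) := by
            refine Finset.sum_le_sum fun t _ => ?_
            rw [Finset.sum_sub_distrib]
            exact sub_le_sub_right (H.sum_bregman_mix_le hz t ω) _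
        _ = ∑ k, bregman X ψ z (x 0 k ω) - ∑ k, bregman X ψ z (x T k ω) :=
            Finset.sum_range_sub' (fun t => ∑ k, bregman X ψ z (x t k ω)) T
        _ ≤ ∑ _k : Fin n, R - 0 := sub_le_sub
            (Finset.sum_le_sum fun k _ => H.isRegularizer.bregman_le hz (H.mem 0 k ω))
            (Finset.sum_nonneg fun k _ => H.isRegularizer.bregman_nonneg hz (H.mem T k ω))
        _ = n * R := by simp
    have hghost : ∑ t ∈ Finset.range T, ∑ k,
        (α t * e t k ω (z - w k t ω) - 1 / 2 * (α t ^ 2 * ‖e t k ω‖ ^ 2)) ≤ n * R := by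
      rw [Finset.sum_comm]
      calc _ ≤ ∑ _k : Fin n, R := by
            refine Finset.sum_le_sum fun k _ => ?_
            rw [Finset.sum_sub_distrib]
            linarith [hw k T ω z hz]
        _ = n * R := by simp
    have hsum : ∑ t ∈ Finset.range T, ∑ k, α t * (h t k ω (v t k ω) - h t k ω z) ≤
        n * R + ∑ t ∈ Finset.range T, ∑ k, c t k ω + n * R := by
      refine (Finset.sum_le_sum fun t _ => Finset.sum_le_sum fun k _ => hstep t k).trans ?_
      simp only [Finset.sum_add_distrib]
      exact add_le_add (add_le_add hbreg le_rfl) hghost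
    calc ∑ t ∈ Finset.range T, α t * ((1 / (n : ℝ)) *
          ∑ k, (h t k ω (v t k ω) - h t k ω z))
        = (1 / (n : ℝ)) * ∑ t ∈ Finset.range T, ∑ k, α t * (h t k ω (v t k ω) - h t k ω z) := by
          rw [Finset.mul_sum]
          refine Finset.sum_congr rfl fun t _ => ?_
          rw [← Finset.mul_sum]
          ring
      _ ≤ (1 / (n : ℝ)) * (n * R + ∑ t ∈ Finset.range T, ∑ k, c t k ω + n * R) :=
          mul_le_mul_of_nonneg_left hsum (by positivity)
      _ = 2 * R + (1 / (n : ℝ)) * ∑ k, ∑ t ∈ Finset.range T, c t k ω := by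
          rw [Finset.sum_comm (s := Finset.range T)]
          field_simp
          ring
  · rw [integral_add (integrable_const _) is, integral_const_mul (1 / (n : ℝ)),
      integral_finsetSum _ fun k _ => integrable_finsetSum _ fun t _ => ic t k]
    simp only [integral_const, probReal_univ, one_smul]
    refine add_le_add_right ?_ _
    rw [one_div, inv_mul_le_iff₀ hn']
    calc ∑ k, ∫ ω, ∑ t ∈ Finset.range T, c t k ω ∂P
        ≤ ∑ _k : Fin n, (1 / 2 * (L + ν) ^ 2 + 1 / 2 * ν ^ 2) *
            ∑ t ∈ Finset.range T, α t ^ 2 := by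
          refine Finset.sum_le_sum fun k _ => ?_
          rw [integral_finsetSum _ fun t _ => ic t k, Finset.mul_sum]
          exact Finset.sum_le_sum fun t _ => hcint t k
      _ = _ := by simp

/-- The expected distances of the states from their mean, summed along the step sizes. -/
theorem exists_consensus_bound (H : IsMirrorDescent P ℱ X ψ α η B G W L ν h x g) (hn : 0 < n)
    (T : ℕ) :
    ∃ K : ℕ → ℝ, (∀ t i, Integrable (fun ω => ‖x t i ω - mean (fun k => x t k ω)‖) P ∧
      ∫ ω, ‖x t i ω - mean (fun k => x t k ω)‖ ∂P ≤ K t) ∧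
      ∑ t ∈ Finset.range T, α t * K t ≤
        n * Gam η n * (∫ ω, (⨆ k, ‖x 0 k ω‖) ∂P) * (α 0 / (1 - theta η n B)) +
          (L + ν) * (n * Gam η n) *
            ((∑ t ∈ Finset.range T, α t ^ 2) / (1 - theta η n B)) := by
  have : ProperSpace E := FiniteDimensional.proper ℝ E
  obtain ⟨C, hC⟩ := H.exists_norm_le
  set Λ := ∫ ω, (⨆ k, ‖x 0 k ω‖) ∂P
  set Gm := Gam η n
  set θ := theta η n B
  have hθ0 : 0 < θ := theta_pos H.η_lt_one hn
  have hθ1 : θ < 1 := theta_lt_one H.η_pos H.η_lt_one hn H.isMixing.one_le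
  have hG : 0 ≤ Gm := inv_nonneg.2 (sq_nonneg _)
  have hΛ : 0 ≤ Λ := integral_nonneg fun ω => Real.iSup_nonneg fun k => norm_nonneg _
  have hLν : 0 ≤ L + ν := add_nonneg H.L_nonneg H.ν_pos.le
  refine ⟨fun t => Gm * θ ^ t * (n * Λ) + ∑ s ∈ Finset.range t,
    Gm * θ ^ (t - 1 - s) * (n * (α s * (L + ν))), fun t i => ?_, ?_⟩
  · set r : ℕ → Fin n → Ω → E := fun t k ω =>
      x (t + 1) k ω - mix (W t) (fun a => x t a ω) k with hr
    have hdet : ∀ ω, ‖x t i ω - mean (fun k => x t k ω)‖ ≤ Gm * θ ^ t * ∑ j, ‖x 0 j ω‖ +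
        ∑ s ∈ Finset.range t, Gm * θ ^ (t - 1 - s) * ∑ j, α s * ‖g s j ω‖ := by
      intro ω
      have h1 := H.isMixing.norm_state_sub_mean_le H.η_pos H.η_lt_one
        (x := fun t k => x t k ω) (r := fun t k => r t k ω)
        (fun t k => by simp only [hr]; abel) t i
      refine h1.trans (add_le_add le_rfl (Finset.sum_le_sum fun s _ => ?_))
      refine mul_le_mul_of_nonneg_left (Finset.sum_le_sum fun j _ => ?_)
        (mul_nonneg hG (pow_nonneg hθ0.le _))
      refine (H.isRegularizer.norm_prox_sub_le (H.mix_mem s j ω) (H.step s j ω)).trans ?_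
      rw [norm_neg, norm_smul, Real.norm_of_nonneg (H.nonneg s)]
    have hi0 : Integrable (fun ω => Gm * θ ^ t * ∑ j, ‖x 0 j ω‖) P :=
      (integrable_finsetSum _ fun j _ => (H.integral_norm_init_le j).1).const_mul _
    have hig : ∀ s j, Integrable (fun ω => α s * ‖g s j ω‖) P := fun s j =>
      (H.sampling s j).integrable.norm.const_mul _
    have higs : ∀ s, Integrable (fun ω => Gm * θ ^ (t - 1 - s) * ∑ j, α s * ‖g s j ω‖) P :=
      fun s => (integrable_finsetSum _ fun j _ => hig s j).const_mul _
    have hi1 : Integrable (fun ω => ∑ s ∈ Finset.range t, Gm * θ ^ (t - 1 - s) *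
        ∑ j, α s * ‖g s j ω‖) P := integrable_finsetSum _ fun s _ => higs s
    have hxm : ∀ k, Measurable (x t k) := fun k => (H.measurable_state t k).mono (H.le t) le_rfl
    have hmean : Measurable fun ω => mean (fun k => x t k ω) :=
      (Finset.measurable_fun_sum _ fun k _ => hxm k).const_smul _
    have hint : Integrable (fun ω => ‖x t i ω - mean (fun k => x t k ω)‖) P := by
      refine (hi0.add hi1).mono' ((hxm i).sub hmean).norm.aestronglyMeasurable
        (ae_of_all _ fun ω => ?_)
      rw [norm_norm]
      exact hdet ω
    refine ⟨hint, (integral_mono hint (hi0.add hi1) hdet).trans ?_⟩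
    rw [integral_add' hi0 hi1, integral_const_mul, integral_finsetSum _ fun s _ => higs s,
      integral_finsetSum _ fun j _ => (H.integral_norm_init_le j).1]
    refine add_le_add ?_ (Finset.sum_le_sum fun s _ => ?_)
    · refine mul_le_mul_of_nonneg_left ?_ (mul_nonneg hG (pow_nonneg hθ0.le _))
      calc ∑ j, ∫ ω, ‖x 0 j ω‖ ∂P ≤ ∑ _j : Fin n, Λ :=
            Finset.sum_le_sum fun j _ => (H.integral_norm_init_le j).2
        _ = n * Λ := by simp
    · rw [integral_const_mul, integral_finsetSum _ fun j _ => hig s j]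
      refine mul_le_mul_of_nonneg_left ?_ (mul_nonneg hG (pow_nonneg hθ0.le _))
      calc ∑ j, ∫ ω, α s * ‖g s j ω‖ ∂P ≤ ∑ _j : Fin n, α s * (L + ν) := by
            refine Finset.sum_le_sum fun j _ => ?_
            rw [integral_const_mul]
            exact mul_le_mul_of_nonneg_left
              ((H.sampling s j).integral_norm_le (H.le s) H.ν_pos) (H.nonneg s)
        _ = n * (α s * (L + ν)) := by simp
  · have h1 := sum_mul_geometric_le H.antitone H.nonneg hθ0.le hθ1 T
    have h2 := sum_mul_convolution_le H.antitone H.nonneg hθ0.le hθ1 T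
    calc ∑ t ∈ Finset.range T, α t * (Gm * θ ^ t * (n * Λ) + ∑ s ∈ Finset.range t,
          Gm * θ ^ (t - 1 - s) * (n * (α s * (L + ν))))
        = n * Gm * Λ * ∑ t ∈ Finset.range T, α t * θ ^ t + (L + ν) * (n * Gm) *
            ∑ t ∈ Finset.range T, α t * ∑ s ∈ Finset.range t, θ ^ (t - 1 - s) * α s := by
          rw [Finset.mul_sum, Finset.mul_sum, ← Finset.sum_add_distrib]
          refine Finset.sum_congr rfl fun t _ => ?_
          have e : ∑ s ∈ Finset.range t, Gm * θ ^ (t - 1 - s) * (n * (α s * (L + ν))) =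
              (L + ν) * (n * Gm) * ∑ s ∈ Finset.range t, θ ^ (t - 1 - s) * α s := by
            rw [Finset.mul_sum]
            exact Finset.sum_congr rfl fun s _ => by ring
          rw [e]
          ring
      _ ≤ _ := by gcongr

end IsMirrorDescent

end OneNetwork

section GameInequalities

variable {E F : Type*} [NormedAddCommGroup E] [NormedAddCommGroup F] {X : Set E} {Y : Set F}
  {L : ℝ}

lemma LipOn.swap {h : E → F → ℝ} (hh : LipOn X Y L h) : LipOn Y X L (fun y x => h x y) :=
  fun y hy y' hy' x hx x' hx' => by
    rw [add_comm ‖y - y'‖]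
    exact hh x hx x' hx' y hy y' hy'

lemma LipOn.neg {h : E → F → ℝ} (hh : LipOn X Y L h) : LipOn X Y L (fun x y => -h x y) :=
  fun x hx x' hx' y hy y' hy' => by
    rw [neg_sub_neg, norm_sub_rev x, norm_sub_rev y]
    exact hh x' hx' x hx y' hy' y hy

lemma LipOn.avgCost {n : ℕ} (hn : 0 < n) {f : Fin n → E → F → ℝ} (hf : ∀ k, LipOn X Y L (f k)) :
    LipOn X Y L (avgCost f) := by
  intro x hx x' hx' y hy y' hy'
  have hn' : (0 : ℝ) < n := by exact_mod_cast hn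
  unfold DSMD.avgCost
  rw [← mul_sub, ← Finset.sum_sub_distrib, abs_mul, abs_of_pos (by positivity), one_div,
    inv_mul_le_iff₀ hn']
  calc |∑ k, (f k x y - f k x' y')| ≤ ∑ k, |f k x y - f k x' y'| :=
        Finset.abs_sum_le_sum_abs _ _
    _ ≤ ∑ _k : Fin n, L * (‖x - x'‖ + ‖y - y'‖) :=
        Finset.sum_le_sum fun k _ => hf k x hx x' hx' y hy y' hy'
    _ = _ := by simp

lemma LipOn.continuousOn_right (hL : 0 ≤ L) {h : E → F → ℝ} (hh : LipOn X Y L h) {x : E}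
    (hx : x ∈ X) : ContinuousOn (h x) Y := by
  refine (LipschitzOnWith.of_dist_le_mul (K := L.toNNReal) fun y hy y' hy' => ?_).continuousOn
  rw [Real.coe_toNNReal L hL, Real.dist_eq, dist_eq_norm]
  simpa using hh x hx x hx y hy y' hy'

lemma LipOn.bddAbove_image (hL : 0 ≤ L) {h : E → F → ℝ} (hh : LipOn X Y L h) (hY : IsCompact Y)
    {x : E} (hx : x ∈ X) : BddAbove (h x '' Y) :=
  hY.bddAbove_image (hh.continuousOn_right hL hx)

lemma LipOn.continuousOn_sSup (hL : 0 ≤ L) {h : E → F → ℝ} (hh : LipOn X Y L h)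
    (hY : IsCompact Y) (hYne : Y.Nonempty) : ContinuousOn (fun x => sSup (h x '' Y)) X := by
  have key : ∀ x ∈ X, ∀ x' ∈ X, sSup (h x '' Y) - sSup (h x' '' Y) ≤ L * ‖x - x'‖ := by
    intro x hx x' hx'
    rw [sub_le_iff_le_add]
    refine csSup_le (hYne.image _) ?_
    rintro _ ⟨y, hy, rfl⟩
    have h1 := le_csSup (hh.bddAbove_image hL hY hx') (mem_image_of_mem _ hy)
    have h2 := (abs_le.1 (hh x hx x' hx' y hy y hy)).2
    rw [sub_self, norm_zero, add_zero] at h2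
    linarith
  refine (LipschitzOnWith.of_dist_le_mul (K := L.toNNReal) fun x hx x' hx' => ?_).continuousOn
  rw [Real.coe_toNNReal L hL, Real.dist_eq, dist_eq_norm, abs_le]
  refine ⟨?_, key x hx x' hx'⟩
  have := key x' hx' x hx
  rw [norm_sub_rev] at this
  linarith

/-- The mean decrease of Lipschitz costs at a reference point, compared with the mean decrease at
the points that the agents know. -/
lemma avgCost_sub_le {n : ℕ} (hn : 0 < n) {f : Fin n → E → F → ℝ}
    (hf : ∀ k, LipOn X Y L (f k)) {a x : E} {b : F} {v : Fin n → E} {u : Fin n → F}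
    (ha : a ∈ X) (hx : x ∈ X) (hb : b ∈ Y) (hv : ∀ k, v k ∈ X) (hu : ∀ k, u k ∈ Y) :
    avgCost f a b - avgCost f x b ≤ (1 / (n : ℝ)) * ∑ k, (f k (v k) (u k) - f k x (u k)) +
      L * ((1 / (n : ℝ)) * ∑ k, ‖v k - a‖ + 2 * ((1 / (n : ℝ)) * ∑ k, ‖u k - b‖)) := by
  have hn' : (0 : ℝ) < n := by exact_mod_cast hn
  have hk : ∀ k, f k a b - f k x b ≤ (f k (v k) (u k) - f k x (u k)) +
      (L * ‖v k - a‖ + 2 * (L * ‖u k - b‖)) := by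
    intro k
    have h1 := (abs_le.1 (hf k a ha (v k) (hv k) b hb (u k) (hu k))).2
    have h2 := (abs_le.1 (hf k x hx x hx (u k) (hu k) b hb)).2
    rw [norm_sub_rev a, norm_sub_rev b] at h1
    rw [sub_self, norm_zero] at h2
    linarith
  unfold avgCost
  have := mul_le_mul_of_nonneg_left (Finset.sum_le_sum fun k (_ : k ∈ Finset.univ) => hk k)
    (show 0 ≤ 1 / (n : ℝ) by positivity)
  simp only [Finset.sum_add_distrib, Finset.sum_sub_distrib, ← Finset.mul_sum] at this ⊢
  linarith

variable [NormedSpace ℝ E] [NormedSpace ℝ F]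

lemma ConvexConcaveOn.avgCost {n : ℕ} {f : Fin n → E → F → ℝ}
    (hX : Convex ℝ X) (hY : Convex ℝ Y) (hf : ∀ k, ConvexConcaveOn X Y (f k)) :
    ConvexConcaveOn X Y (avgCost f) := by
  constructor
  · intro y hy
    refine ⟨hX, fun x hx x' hx' a b ha hb hab => ?_⟩
    simp only [DSMD.avgCost, smul_eq_mul]
    calc _ ≤ (1 / (n : ℝ)) * ∑ k, (a * f k x y + b * f k x' y) :=
          mul_le_mul_of_nonneg_left (Finset.sum_le_sum fun k _ =>
            ((hf k).1 y hy).2 hx hx' ha hb hab) (by positivity)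
      _ = _ := by rw [Finset.sum_add_distrib, ← Finset.mul_sum, ← Finset.mul_sum]; ring
  · intro x hx
    refine ⟨hY, fun y hy y' hy' a b ha hb hab => ?_⟩
    simp only [DSMD.avgCost, smul_eq_mul]
    calc _ = (1 / (n : ℝ)) * ∑ k, (a * f k x y + b * f k x y') := by
          rw [Finset.sum_add_distrib, ← Finset.mul_sum, ← Finset.mul_sum]; ring
      _ ≤ _ := mul_le_mul_of_nonneg_left (Finset.sum_le_sum fun k _ =>
            ((hf k).2 x hx).2 hy hy' ha hb hab) (by positivity)

lemma timeAvg_mem (hX : Convex ℝ X) {α : ℕ → ℝ} {x : ℕ → E} {t : ℕ} (hα : ∀ s, 0 ≤ α s)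
    (hpos : 0 < ∑ s ∈ Finset.range t, α s) (hx : ∀ s, x s ∈ X) : timeAvg α x t ∈ X :=
  hX.centerMass_mem (fun s _ => hα s) hpos fun s _ => hx s

lemma _root_.ConvexOn.mul_timeAvg_le {f : E → ℝ} (hf : ConvexOn ℝ X f) {α : ℕ → ℝ} {x : ℕ → E}
    {t : ℕ} (hα : ∀ s, 0 ≤ α s) (hpos : 0 < ∑ s ∈ Finset.range t, α s) (hx : ∀ s, x s ∈ X) :
    (∑ s ∈ Finset.range t, α s) * f (timeAvg α x t) ≤ ∑ s ∈ Finset.range t, α s * f (x s) := by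
  have h : f (timeAvg α x t) ≤
      (∑ s ∈ Finset.range t, α s)⁻¹ • ∑ s ∈ Finset.range t, α s • f (x s) :=
    hf.map_centerMass_le (fun s _ => hα s) hpos fun s _ => hx s
  rwa [smul_eq_mul, ← div_eq_inv_mul, le_div_iff₀' hpos] at h

end GameInequalities

section AvgMix

variable {Ω : Type*} [MeasurableSpace Ω] {P : Measure Ω} {m n : ℕ}

/-- The mean over the receiving agents of their weighted averages of real quantities. -/
def avgMix (w : Matrix (Fin m) (Fin n) ℝ) (D : Fin n → ℝ) : ℝ :=
  (1 / (m : ℝ)) * ∑ k, ∑ j, w k j * D j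

lemma avgMix_norm_le {E : Type*} [NormedAddCommGroup E] [NormedSpace ℝ E]
    {w : Matrix (Fin m) (Fin n) ℝ} (hw : ∀ k j, 0 ≤ w k j) (hsum : ∀ k, ∑ j, w k j = 1)
    (x : Fin n → E) (c : E) :
    (1 / (m : ℝ)) * ∑ k, ‖mix w x k - c‖ ≤ avgMix w fun j => ‖x j - c‖ :=
  mul_le_mul_of_nonneg_left (Finset.sum_le_sum fun k _ => norm_mix_sub_le (hw k) (hsum k) c)
    (by positivity)

lemma integrable_avgMix (w : Matrix (Fin m) (Fin n) ℝ) {D : Fin n → Ω → ℝ}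
    (hD : ∀ j, Integrable (D j) P) : Integrable (fun ω => avgMix w fun j => D j ω) P :=
  (integrable_finsetSum _ fun _ _ => integrable_finsetSum _ fun j _ =>
    (hD j).const_mul _).const_mul _

lemma integral_avgMix_le (hm : 0 < m) {w : Matrix (Fin m) (Fin n) ℝ} (hw : ∀ k j, 0 ≤ w k j)
    (hsum : ∀ k, ∑ j, w k j = 1) {D : Fin n → Ω → ℝ} (hD : ∀ j, Integrable (D j) P) {K : ℝ}
    (hK : ∀ j, ∫ ω, D j ω ∂P ≤ K) : ∫ ω, avgMix w (fun j => D j ω) ∂P ≤ K := by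
  have hm' : (0 : ℝ) < m := by exact_mod_cast hm
  have hi : ∀ k, Integrable (fun ω => ∑ j, w k j * D j ω) P := fun k =>
    integrable_finsetSum _ fun j _ => (hD j).const_mul _
  simp only [avgMix]
  rw [integral_const_mul, integral_finsetSum _ fun k _ => hi k, one_div, inv_mul_le_iff₀ hm']
  calc ∑ k, ∫ ω, ∑ j, w k j * D j ω ∂P ≤ ∑ _k : Fin m, K := by
        refine Finset.sum_le_sum fun k _ => ?_
        rw [integral_finsetSum _ fun j _ => (hD j).const_mul _]
        calc ∑ j, ∫ ω, w k j * D j ω ∂P ≤ ∑ j, w k j * K :=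
              Finset.sum_le_sum fun j _ => by
                rw [integral_const_mul]
                exact mul_le_mul_of_nonneg_left (hK j) (hw k j)
          _ = K := by rw [← Finset.sum_mul, hsum, one_mul]
    _ = m * K := by simp

end AvgMix

section History

variable {Ω E₁ E₂ : Type*} [MeasurableSpace E₁] [MeasurableSpace E₂] {n₁ n₂ d : ℕ}
  {x₁ : Fin n₁ → Ω → E₁} {x₂ : Fin n₂ → Ω → E₂}
  {ξ : ℕ → Fin n₁ ⊕ Fin n₂ → Ω → Fin d → ℝ}

lemma history_mono : Monotone (history x₁ x₂ ξ) := fun _ _ hst =>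
  sup_le_sup le_rfl (iSup_mono fun _ => iSup_mono' fun h => ⟨h.trans_le hst, le_rfl⟩)

lemma history_le [mΩ : MeasurableSpace Ω] (h₁ : ∀ i, Measurable (x₁ i))
    (h₂ : ∀ j, Measurable (x₂ j))
    (hξ : ∀ t k, Measurable (ξ t k)) (t : ℕ) : history x₁ x₂ ξ t ≤ mΩ :=
  sup_le (sup_le (iSup_le fun i => (h₁ i).comap_le) (iSup_le fun j => (h₂ j).comap_le))
    (iSup_le fun s => iSup_le fun _ => iSup_le fun k => (hξ s k).comap_le)

lemma measurable_history_left (t : ℕ) (i : Fin n₁) : Measurable[history x₁ x₂ ξ t] (x₁ i) :=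
  Measurable.of_comap_le (le_sup_of_le_left (le_sup_of_le_left (le_iSup_of_le i le_rfl)))

lemma measurable_history_right (t : ℕ) (j : Fin n₂) : Measurable[history x₁ x₂ ξ t] (x₂ j) :=
  Measurable.of_comap_le (le_sup_of_le_left (le_sup_of_le_right (le_iSup_of_le j le_rfl)))

end History

section GameRun

variable {Ω E₁ E₂ : Type*} [mΩ : MeasurableSpace Ω]
  [NormedAddCommGroup E₁] [NormedSpace ℝ E₁] [NormedAddCommGroup E₂] [NormedSpace ℝ E₂]
  {P : Measure Ω} {n₁ n₂ d : ℕ} {Γ : Game P E₁ E₂ n₁ n₂ d} {L : ℝ}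

namespace Game

lemma U_eq_neg_avgCost (Γ : Game P E₁ E₂ n₁ n₂ d) {x₁ : E₁} {x₂ : E₂} (h₁ : x₁ ∈ Γ.X₁)
    (h₂ : x₂ ∈ Γ.X₂) : Γ.U x₁ x₂ = -avgCost Γ.f₂ x₁ x₂ := Γ.zero_sum x₁ h₁ x₂ h₂

lemma LipschitzAssumption.lipOn_U (h : Γ.LipschitzAssumption L) (hn : 0 < n₁) :
    LipOn Γ.X₁ Γ.X₂ L Γ.U := LipOn.avgCost hn h.2.1

lemma gap_eq (Γ : Game P E₁ E₂ n₁ n₂ d) (y₁ : E₁) (y₂ : E₂) :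
    Γ.gap y₁ y₂ = sSup (Γ.U y₁ '' Γ.X₂) + sSup ((fun x₁ => -Γ.U x₁ y₂) '' Γ.X₁) := by
  have : (fun x₁ => -Γ.U x₁ y₂) '' Γ.X₁ = -((fun x₁ => Γ.U x₁ y₂) '' Γ.X₁) := by
    rw [← Set.image_neg_eq_neg, Set.image_image]
  rw [gap, Real.sInf_def, this, sub_neg_eq_add]

lemma gap_le (Γ : Game P E₁ E₂ n₁ n₂ d) {y₁ : E₁} {y₂ : E₂} {c : ℝ}
    (h : ∀ x₁ ∈ Γ.X₁, ∀ x₂ ∈ Γ.X₂, Γ.U y₁ x₂ - Γ.U x₁ y₂ ≤ c) : Γ.gap y₁ y₂ ≤ c := by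
  rw [gap, sub_le_iff_le_add]
  refine csSup_le (Γ.nonempty₂.image _) ?_
  rintro _ ⟨x₂, hx₂, rfl⟩
  rw [← sub_le_iff_le_add']
  refine le_csInf (Γ.nonempty₁.image _) ?_
  rintro _ ⟨x₁, hx₁, rfl⟩
  linarith [h x₁ hx₁ x₂ hx₂]

lemma integrable_gap [IsProbabilityMeasure P] [MeasurableSpace E₁] [BorelSpace E₁]
    [MeasurableSpace E₂] [BorelSpace E₂] (hn : 0 < n₁) (h : Γ.LipschitzAssumption L)
    {y₁ : Ω → E₁} {y₂ : Ω → E₂} (hm₁ : Measurable y₁) (hm₂ : Measurable y₂)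
    (h₁ : ∀ ω, y₁ ω ∈ Γ.X₁) (h₂ : ∀ ω, y₂ ω ∈ Γ.X₂) :
    Integrable (fun ω => Γ.gap (y₁ ω) (y₂ ω)) P := by
  have hU := h.lipOn_U hn
  have c1 := hU.continuousOn_sSup h.1.le Γ.compact₂ Γ.nonempty₂
  have c2 := hU.neg.swap.continuousOn_sSup h.1.le Γ.compact₁ Γ.nonempty₁
  obtain ⟨C₁, hC₁⟩ := Γ.compact₁.exists_bound_of_continuousOn c1
  obtain ⟨C₂, hC₂⟩ := Γ.compact₂.exists_bound_of_continuousOn c2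
  simp only [gap_eq]
  exact (Integrable.of_bound (c1.measurable_comp_of_mem hm₁ h₁).aestronglyMeasurable C₁
    (ae_of_all _ fun ω => hC₁ _ (h₁ ω))).add
    (Integrable.of_bound (c2.measurable_comp_of_mem hm₂ h₂).aestronglyMeasurable C₂
    (ae_of_all _ fun ω => hC₂ _ (h₂ ω)))

/-- The difference of two values of the game in terms of the regrets of the agents and of the
distances from the means of the two networks. -/
lemma U_sub_U_le (hn₁ : 0 < n₁) (hn₂ : 0 < n₂) (h : Γ.LipschitzAssumption L)
    {p a x₁ : E₁} {q b x₂ : E₂} (hp : p ∈ Γ.X₁) (ha : a ∈ Γ.X₁) (hx₁ : x₁ ∈ Γ.X₁)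
    (hq : q ∈ Γ.X₂) (hb : b ∈ Γ.X₂) (hx₂ : x₂ ∈ Γ.X₂)
    {v₁ : Fin n₁ → E₁} {u₂ : Fin n₁ → E₂} {v₂ : Fin n₂ → E₂} {u₁ : Fin n₂ → E₁}
    (hv₁ : ∀ k, v₁ k ∈ Γ.X₁) (hu₂ : ∀ k, u₂ k ∈ Γ.X₂)
    (hv₂ : ∀ k, v₂ k ∈ Γ.X₂) (hu₁ : ∀ k, u₁ k ∈ Γ.X₁) :
    Γ.U p x₂ - Γ.U x₁ q ≤
      (1 / (n₁ : ℝ)) * ∑ k, (Γ.f₁ k (v₁ k) (u₂ k) - Γ.f₁ k x₁ (u₂ k)) +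
      (1 / (n₂ : ℝ)) * ∑ k, (Γ.f₂ k (u₁ k) (v₂ k) - Γ.f₂ k (u₁ k) x₂) +
      L * (‖p - a‖ + ‖q - b‖ +
        ((1 / (n₁ : ℝ)) * ∑ k, ‖v₁ k - a‖ + 2 * ((1 / (n₁ : ℝ)) * ∑ k, ‖u₂ k - b‖)) +
        ((1 / (n₂ : ℝ)) * ∑ k, ‖v₂ k - b‖ + 2 * ((1 / (n₂ : ℝ)) * ∑ k, ‖u₁ k - a‖))) := by
  have hU := h.lipOn_U hn₁
  have e1 := avgCost_sub_le hn₁ h.2.1 ha hx₁ hb hv₁ hu₂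
  have e2 := avgCost_sub_le hn₂ (f := fun k y x => Γ.f₂ k x y) (fun k => (h.2.2 k).swap)
    hb hx₂ ha hv₂ hu₁
  have e3 := Γ.U_eq_neg_avgCost ha hb
  have e4 := Γ.U_eq_neg_avgCost ha hx₂
  have e5 := (abs_le.1 (hU p hp a ha x₂ hx₂ x₂ hx₂)).2
  have e6 := (abs_le.1 (hU x₁ hx₁ x₁ hx₁ b hb q hq)).2
  rw [sub_self, norm_zero] at e5 e6
  rw [norm_sub_rev b] at e6
  change Γ.U a b - Γ.U x₁ b ≤ _ at e1
  change avgCost Γ.f₂ a b - avgCost Γ.f₂ a x₂ ≤ _ at e2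
  linarith

end Game

namespace Run

variable [MeasurableSpace E₁] [MeasurableSpace E₂]
  {η : ℝ} {B₁ B₂ : ℕ} {N : Network n₁ n₂ η B₁ B₂}
  {ψ₁ : E₁ → ℝ} {ψ₂ : E₂ → ℝ} {α : ℕ → ℝ} {ν₁ ν₂ : ℝ}

lemma isMirrorDescent₁ (R : Run Γ N ψ₁ ψ₂ α) (hψ : IsRegularizer Γ.X₁ ψ₁)
    (hB : BregmanAssumption Γ.X₁ ψ₁) (hα : Antitone α) (hα0 : ∀ t, 0 ≤ α t) (hL : 0 ≤ L)
    (hS : R.SamplingAssumption L ν₁ ν₂) :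
    IsMirrorDescent P (history (R.x₁ 0) (R.x₂ 0) R.ξ) Γ.X₁ ψ₁ α η B₁ N.G₁ N.W₁ L ν₁
      (fun t i ω y => Γ.f₁ i y (mix (N.W₁₂ t) (fun j => R.x₂ t j ω) i)) R.x₁ R.g₁ where
  isCompact := Γ.compact₁
  isRegularizer := hψ
  convexOn_right := hB.convexOn_right
  monotone := history_mono
  le := history_le R.measurable_init₁ R.measurable_init₂ R.measurable_ξ
  isMixing := N.mixing₁
  η_pos := N.η_pos
  η_lt_one := N.η_lt_one
  antitone := hα
  nonneg := hα0
  L_nonneg := hL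
  ν_pos := hS.1
  measurable_init := measurable_history_left 0
  init_mem := R.init_mem₁
  measurable_subgradient := R.measurable_g₁
  step := R.step₁
  sampling := hS.2.2.1

lemma isMirrorDescent₂ (R : Run Γ N ψ₁ ψ₂ α) (hψ : IsRegularizer Γ.X₂ ψ₂)
    (hB : BregmanAssumption Γ.X₂ ψ₂) (hα : Antitone α) (hα0 : ∀ t, 0 ≤ α t) (hL : 0 ≤ L)
    (hS : R.SamplingAssumption L ν₁ ν₂) :
    IsMirrorDescent P (history (R.x₁ 0) (R.x₂ 0) R.ξ) Γ.X₂ ψ₂ α η B₂ N.G₂ N.W₂ L ν₂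
      (fun t j ω y => Γ.f₂ j (mix (N.W₂₁ t) (fun i => R.x₁ t i ω) j) y) R.x₂ R.g₂ where
  isCompact := Γ.compact₂
  isRegularizer := hψ
  convexOn_right := hB.convexOn_right
  monotone := history_mono
  le := history_le R.measurable_init₁ R.measurable_init₂ R.measurable_ξ
  isMixing := N.mixing₂
  η_pos := N.η_pos
  η_lt_one := N.η_lt_one
  antitone := hα
  nonneg := hα0
  L_nonneg := hL
  ν_pos := hS.2.1
  measurable_init := measurable_history_right 0
  init_mem := R.init_mem₂
  measurable_subgradient := R.measurable_g₂
  step := R.step₂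
  sampling := hS.2.2.2

end Run

end GameRun

lemma consensus_add_regret_le {L ν η : ℝ} {n B : ℕ} {Λ α₀ Rsq S : ℝ} (hL : 0 ≤ L) (hν : 0 ≤ ν)
    (hS : 0 ≤ S) :
    4 * L * (n * Gam η n * Λ * (α₀ / (1 - theta η n B)) +
        (L + ν) * (n * Gam η n) * (S / (1 - theta η n B))) +
      (2 * Rsq + (1 / 2 * (L + ν) ^ 2 + 1 / 2 * ν ^ 2) * S) ≤
      constM₁ L η n B Λ α₀ Rsq + constM₂ L ν η n B * S := by
  have h1 : 0 ≤ (8 * (L * (L + ν)) + 1 / 2 * (L + ν) ^ 2) * S := by positivity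
  have h2 : constM₁ L η n B Λ α₀ Rsq + constM₂ L ν η n B * S =
      4 * L * (n * Gam η n * Λ * (α₀ / (1 - theta η n B)) +
        (L + ν) * (n * Gam η n) * (S / (1 - theta η n B))) +
      (2 * Rsq + (1 / 2 * (L + ν) ^ 2 + 1 / 2 * ν ^ 2) * S) +
      (8 * (L * (L + ν)) + 1 / 2 * (L + ν) ^ 2) * S := by
    unfold constM₁ constM₂
    simp only [div_eq_mul_inv]
    ring
  linarith

end DSMD

end

theorem theorem4 {Ω E₁ E₂ : Type*} [MeasurableSpace Ω]
    [NormedAddCommGroup E₁] [NormedSpace ℝ E₁] [FiniteDimensional ℝ E₁]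
    [MeasurableSpace E₁] [BorelSpace E₁]
    [NormedAddCommGroup E₂] [NormedSpace ℝ E₂] [FiniteDimensional ℝ E₂]
    [MeasurableSpace E₂] [BorelSpace E₂]
    (P : Measure Ω) [IsProbabilityMeasure P] {n₁ n₂ d : ℕ}
    (Γ : DSMD.Game P E₁ E₂ n₁ n₂ d)
    {η : ℝ} {B₁ B₂ : ℕ} (N : DSMD.Network n₁ n₂ η B₁ B₂)
    (ψ₁ : E₁ → ℝ) (ψ₂ : E₂ → ℝ)
    (hψ₁ : DSMD.IsRegularizer Γ.X₁ ψ₁) (hψ₂ : DSMD.IsRegularizer Γ.X₂ ψ₂)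
    (α : ℕ → ℝ) (hα_anti : Antitone α) (hα_nonneg : ∀ t, 0 ≤ α t) (hα_zero : 0 < α 0)
    (R : DSMD.Run Γ N ψ₁ ψ₂ α) (L ν₁ ν₂ : ℝ)
    (hcc : Γ.CostsConvexConcave)
    (hLip : Γ.LipschitzAssumption L)
    (hSamp : R.SamplingAssumption L ν₁ ν₂)
    (hBreg₁ : DSMD.BregmanAssumption Γ.X₁ ψ₁) (hBreg₂ : DSMD.BregmanAssumption Γ.X₂ ψ₂)
    (i : Fin n₁) (j : Fin n₂) (t : ℕ) (ht : 1 ≤ t) :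
    Integrable (fun ω => Γ.gap (DSMD.timeAvg α (fun s => R.x₁ s i ω) t)
      (DSMD.timeAvg α (fun s => R.x₂ s j ω) t)) P ∧
    ∫ ω, Γ.gap (DSMD.timeAvg α (fun s => R.x₁ s i ω) t)
      (DSMD.timeAvg α (fun s => R.x₂ s j ω) t) ∂P ≤
      ((DSMD.constM₁ L η n₁ B₁ R.Lam₁ (α 0) (DSMD.bregmanDiamSq Γ.X₁ ψ₁) +
          DSMD.constM₁ L η n₂ B₂ R.Lam₂ (α 0) (DSMD.bregmanDiamSq Γ.X₂ ψ₂)) +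
        (DSMD.constM₂ L ν₁ η n₁ B₁ + DSMD.constM₂ L ν₂ η n₂ B₂) *
          ∑ s ∈ Finset.range t, α s ^ 2) /
      ∑ s ∈ Finset.range t, α s := by
  have hn₁ : 0 < n₁ := i.pos
  have hn₂ : 0 < n₂ := j.pos
  have hL : 0 < L := hLip.1
  have H₁ := R.isMirrorDescent₁ hψ₁ hBreg₁ hα_anti hα_nonneg hL.le hSamp
  have H₂ := R.isMirrorDescent₂ hψ₂ hBreg₂ hα_anti hα_nonneg hL.le hSamp
  have : ProperSpace E₁ := FiniteDimensional.proper ℝ E₁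
  have : ProperSpace E₂ := FiniteDimensional.proper ℝ E₂
  have hpos : 0 < ∑ s ∈ Finset.range t, α s :=
    Finset.sum_pos' (fun s _ => hα_nonneg s) ⟨0, Finset.mem_range.2 ht, hα_zero⟩
  have hS : 0 ≤ ∑ s ∈ Finset.range t, α s ^ 2 := Finset.sum_nonneg fun s _ => sq_nonneg _
  have hmem₁ : ∀ ω, DSMD.timeAvg α (fun s => R.x₁ s i ω) t ∈ Γ.X₁ := fun ω =>
    DSMD.timeAvg_mem Γ.convex₁ hα_nonneg hpos fun s => H₁.mem s i ω
  have hmem₂ : ∀ ω, DSMD.timeAvg α (fun s => R.x₂ s j ω) t ∈ Γ.X₂ := fun ω =>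
    DSMD.timeAvg_mem Γ.convex₂ hα_nonneg hpos fun s => H₂.mem s j ω
  have hmeas₁ : Measurable fun ω => DSMD.timeAvg α (fun s => R.x₁ s i ω) t :=
    (Finset.measurable_fun_sum _ fun s _ =>
      ((H₁.measurable_state s i).mono (H₁.le s) le_rfl).const_smul _).const_smul _
  have hmeas₂ : Measurable fun ω => DSMD.timeAvg α (fun s => R.x₂ s j ω) t :=
    (Finset.measurable_fun_sum _ fun s _ =>
      ((H₂.measurable_state s j).mono (H₂.le s) le_rfl).const_smul _).const_smul _
  have hgap := DSMD.Game.integrable_gap hn₁ hLip hmeas₁ hmeas₂ hmem₁ hmem₂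
  refine ⟨hgap, ?_⟩
  obtain ⟨Ψ₁, hΨ₁, hreg₁, hE₁⟩ := H₁.exists_regret_bound hn₁ t
  obtain ⟨Ψ₂, hΨ₂, hreg₂, hE₂⟩ := H₂.exists_regret_bound hn₂ t
  obtain ⟨K₁, hK₁, hsum₁⟩ := H₁.exists_consensus_bound hn₁ t
  obtain ⟨K₂, hK₂, hsum₂⟩ := H₂.exists_consensus_bound hn₂ t
  set D₁ : ℕ → Fin n₁ → Ω → ℝ := fun s k ω =>
    ‖R.x₁ s k ω - DSMD.mean (fun a => R.x₁ s a ω)‖ with hD₁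
  set D₂ : ℕ → Fin n₂ → Ω → ℝ := fun s k ω =>
    ‖R.x₂ s k ω - DSMD.mean (fun a => R.x₂ s a ω)‖ with hD₂
  set err : ℕ → Ω → ℝ := fun s ω => L * (D₁ s i ω + D₂ s j ω +
    (DSMD.avgMix (N.W₁ s) (fun k => D₁ s k ω) + 2 * DSMD.avgMix (N.W₁₂ s) (fun k => D₂ s k ω)) +
    (DSMD.avgMix (N.W₂ s) (fun k => D₂ s k ω) + 2 * DSMD.avgMix (N.W₂₁ s) (fun k => D₁ s k ω)))
    with herr
  have iD₁ : ∀ s k, Integrable (D₁ s k) P := fun s k => (hK₁ s k).1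
  have iD₂ : ∀ s k, Integrable (D₂ s k) P := fun s k => (hK₂ s k).1
  have w₁ := fun s => N.mixing₁.weight_nonneg N.η_pos s
  have w₂ := fun s => N.mixing₂.weight_nonneg N.η_pos s
  have herrint : ∀ s, Integrable (err s) P ∧ ∫ ω, err s ω ∂P ≤ 4 * L * (K₁ s + K₂ s) := by
    intro s
    have a1 := DSMD.integrable_avgMix (N.W₁ s) (iD₁ s)
    have a2 := (DSMD.integrable_avgMix (N.W₁₂ s) (iD₂ s)).const_mul 2
    have a3 := DSMD.integrable_avgMix (N.W₂ s) (iD₂ s)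
    have a4 := (DSMD.integrable_avgMix (N.W₂₁ s) (iD₁ s)).const_mul 2
    have b1 := DSMD.integral_avgMix_le hn₁ (w₁ s) (N.mixing₁.row_sum s) (iD₁ s)
      fun k => (hK₁ s k).2
    have b2 := DSMD.integral_avgMix_le hn₁ (N.nonneg₁₂ s) (N.row_sum₁₂ s) (iD₂ s)
      fun k => (hK₂ s k).2
    have b3 := DSMD.integral_avgMix_le hn₂ (w₂ s) (N.mixing₂.row_sum s) (iD₂ s)
      fun k => (hK₂ s k).2
    have b4 := DSMD.integral_avgMix_le hn₂ (N.nonneg₂₁ s) (N.row_sum₂₁ s) (iD₁ s)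
      fun k => (hK₁ s k).2
    have c0 := (iD₁ s i).add (iD₂ s j)
    have c1 := a1.add a2
    have c2 := a3.add a4
    refine ⟨((c0.add c1).add c2).const_mul L, ?_⟩
    have e : ∫ ω, err s ω ∂P = L * (∫ ω, D₁ s i ω ∂P + ∫ ω, D₂ s j ω ∂P +
        (∫ ω, DSMD.avgMix (N.W₁ s) (fun k => D₁ s k ω) ∂P +
          2 * ∫ ω, DSMD.avgMix (N.W₁₂ s) (fun k => D₂ s k ω) ∂P) +
        (∫ ω, DSMD.avgMix (N.W₂ s) (fun k => D₂ s k ω) ∂P +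
          2 * ∫ ω, DSMD.avgMix (N.W₂₁ s) (fun k => D₁ s k ω) ∂P)) := by
      rw [← integral_const_mul 2, ← integral_const_mul 2, ← integral_add' (iD₁ s i) (iD₂ s j),
        ← integral_add' a1 a2, ← integral_add' a3 a4, ← integral_add' c0 c1,
        ← integral_add' (c0.add c1) c2, ← integral_const_mul L]
      rfl
    have d1 := (hK₁ s i).2
    have d2 := (hK₂ s j).2
    calc ∫ ω, err s ω ∂P ≤ L * (K₁ s + K₂ s + (K₁ s + 2 * K₂ s) + (K₂ s + 2 * K₁ s)) := by
          rw [e]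
          exact mul_le_mul_of_nonneg_left (by linarith) hL.le
      _ = _ := by ring
  have ierr : Integrable (fun ω => ∑ s ∈ Finset.range t, α s * err s ω) P :=
    integrable_finsetSum _ fun s _ => (herrint s).1.const_mul _
  have hcc_U : DSMD.ConvexConcaveOn Γ.X₁ Γ.X₂ Γ.U :=
    DSMD.ConvexConcaveOn.avgCost Γ.convex₁ Γ.convex₂ hcc.1
  have hbound : ∀ᵐ ω ∂P, Γ.gap (DSMD.timeAvg α (fun s => R.x₁ s i ω) t)
      (DSMD.timeAvg α (fun s => R.x₂ s j ω) t) ≤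
      (∑ s ∈ Finset.range t, α s)⁻¹ *
        (Ψ₁ ω + Ψ₂ ω + ∑ s ∈ Finset.range t, α s * err s ω) := by
    filter_upwards [hreg₁, hreg₂] with ω hω₁ hω₂
    refine Γ.gap_le fun x₁ hx₁ x₂ hx₂ => ?_
    rw [← div_eq_inv_mul, le_div_iff₀' hpos]
    have j₁ := (hcc_U.1 x₂ hx₂).mul_timeAvg_le hα_nonneg hpos (fun s => H₁.mem s i ω)
    have j₂ := (hcc_U.2 x₁ hx₁).neg.mul_timeAvg_le hα_nonneg hpos (fun s => H₂.mem s j ω)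
    have hs : ∀ s, α s * (Γ.U (R.x₁ s i ω) x₂ - Γ.U x₁ (R.x₂ s j ω)) ≤
        α s * ((1 / (n₁ : ℝ)) * ∑ k,
          (Γ.f₁ k (DSMD.mix (N.W₁ s) (fun a => R.x₁ s a ω) k)
            (DSMD.mix (N.W₁₂ s) (fun b => R.x₂ s b ω) k) -
          Γ.f₁ k x₁ (DSMD.mix (N.W₁₂ s) (fun b => R.x₂ s b ω) k))) +
        α s * ((1 / (n₂ : ℝ)) * ∑ k,
          (Γ.f₂ k (DSMD.mix (N.W₂₁ s) (fun a => R.x₁ s a ω) k)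
            (DSMD.mix (N.W₂ s) (fun b => R.x₂ s b ω) k) -
          Γ.f₂ k (DSMD.mix (N.W₂₁ s) (fun a => R.x₁ s a ω) k) x₂)) + α s * err s ω := by
      intro s
      rw [← mul_add, ← mul_add]
      refine mul_le_mul_of_nonneg_left ?_ (hα_nonneg s)
      refine (DSMD.Game.U_sub_U_le hn₁ hn₂ hLip
        (a := DSMD.mean (fun a => R.x₁ s a ω)) (b := DSMD.mean (fun a => R.x₂ s a ω))
        (H₁.mem s i ω) (DSMD.mean_mem Γ.convex₁ hn₁ fun k => H₁.mem s k ω) hx₁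
        (H₂.mem s j ω) (DSMD.mean_mem Γ.convex₂ hn₂ fun k => H₂.mem s k ω) hx₂
        (fun k => H₁.mix_mem s k ω)
        (fun k => DSMD.mix_mem Γ.convex₂ (N.nonneg₁₂ s k) (N.row_sum₁₂ s k)
          fun b => H₂.mem s b ω)
        (fun k => H₂.mix_mem s k ω)
        (fun k => DSMD.mix_mem Γ.convex₁ (N.nonneg₂₁ s k) (N.row_sum₂₁ s k)
          fun b => H₁.mem s b ω)).trans ?_
      refine add_le_add le_rfl (mul_le_mul_of_nonneg_left ?_ hL.le)
      have m1 := DSMD.avgMix_norm_le (w₁ s) (N.mixing₁.row_sum s) (fun a => R.x₁ s a ω)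
        (DSMD.mean (fun a => R.x₁ s a ω))
      have m2 := DSMD.avgMix_norm_le (N.nonneg₁₂ s) (N.row_sum₁₂ s) (fun a => R.x₂ s a ω)
        (DSMD.mean (fun a => R.x₂ s a ω))
      have m3 := DSMD.avgMix_norm_le (w₂ s) (N.mixing₂.row_sum s) (fun a => R.x₂ s a ω)
        (DSMD.mean (fun a => R.x₂ s a ω))
      have m4 := DSMD.avgMix_norm_le (N.nonneg₂₁ s) (N.row_sum₂₁ s) (fun a => R.x₁ s a ω)
        (DSMD.mean (fun a => R.x₁ s a ω))
      linarith
    have hsum := Finset.sum_le_sum fun s (_ : s ∈ Finset.range t) => hs s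
    simp only [Finset.sum_add_distrib, mul_sub, Finset.sum_sub_distrib] at hsum
    have r₁ := hω₁ x₁ hx₁
    have r₂ := hω₂ x₂ hx₂
    simp only [Finset.sum_sub_distrib, mul_sub] at r₁ r₂
    simp only [Pi.neg_apply, mul_neg, Finset.sum_neg_distrib] at j₂
    rw [mul_sub]
    linarith
  have iΨ : Integrable (fun ω => Ψ₁ ω + Ψ₂ ω) P := hΨ₁.add hΨ₂
  have itot : Integrable (fun ω => Ψ₁ ω + Ψ₂ ω + ∑ s ∈ Finset.range t, α s * err s ω) P :=
    iΨ.add ierr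
  refine (integral_mono_ae hgap (itot.const_mul _) hbound).trans ?_
  rw [integral_const_mul, ← div_eq_inv_mul]
  refine div_le_div_of_nonneg_right ?_ hpos.le
  rw [integral_add iΨ ierr, integral_add hΨ₁ hΨ₂,
    integral_finsetSum _ fun s _ => (herrint s).1.const_mul _]
  have htot : ∑ s ∈ Finset.range t, ∫ ω, α s * err s ω ∂P ≤
      4 * L * (∑ s ∈ Finset.range t, α s * K₁ s + ∑ s ∈ Finset.range t, α s * K₂ s) := by
    rw [← Finset.sum_add_distrib, Finset.mul_sum]
    refine Finset.sum_le_sum fun s _ => ?_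
    rw [integral_const_mul]
    calc α s * ∫ ω, err s ω ∂P ≤ α s * (4 * L * (K₁ s + K₂ s)) :=
          mul_le_mul_of_nonneg_left (herrint s).2 (hα_nonneg s)
      _ = _ := by ring
  have f₁ := DSMD.consensus_add_regret_le (η := η) (n := n₁) (B := B₁) (Λ := R.Lam₁)
    (α₀ := α 0) (Rsq := DSMD.bregmanDiamSq Γ.X₁ ψ₁) hL.le hSamp.1.le hS
  have f₂ := DSMD.consensus_add_regret_le (η := η) (n := n₂) (B := B₂) (Λ := R.Lam₂)
    (α₀ := α 0) (Rsq := DSMD.bregmanDiamSq Γ.X₂ ψ₂) hL.le hSamp.2.1.le hS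
  have g₁ := mul_le_mul_of_nonneg_left hsum₁ (show 0 ≤ 4 * L by positivity)
  have g₂ := mul_le_mul_of_nonneg_left hsum₂ (show 0 ≤ 4 * L by positivity)
  rw [add_mul]
  simp only [DSMD.Run.Lam₁, DSMD.Run.Lam₂] at f₁ f₂ ⊢
  linarith
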